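/- **Proposition 1 (Hidden regularity).** Let $\Omega=(0,1)$, $T>0$, $Q_T=\Omega\times(0,T)$. Let $H^1_{(0)}(\Omega)=\{z\in H^1(\Omega):\ z(0)=0\}$ with the norm $\|z\|_{H^1_{(0)}(\Omega)}=\|\partial_x z\|_{L^2(\Omega)}$, and let $H^{-1}_{(0)}(\Omega)$ be its dual space with the dual norm. There is a constant $C>0$, depending only on $T$ (and on the fixed domain $\Omega$), such that the following holds for all $A\in L^\infty(Q_T)$ and all $(\varphi_0,\varphi_1)\in L^2(\Omega)\times H^{-1}_{(0)}(\Omega)$. Let $\varphi\in L^2(Q_T)$ be the solution in the sense of transposition of $$\partial_{tt}\varphi-\partial_{xx}\varphi+A\varphi=0\ \text{ in }Q_T,\qquad \varphi(0,\cdot)=0,\ \ \partial_x\varphi(1,\cdot)=0\ \text{ on }(0,T),\qquad (\varphi,\partial_t\varphi)(\cdot,0)=(\varphi_0,\varphi_1)\ \text{ in }\Omega,$$ that is, $$\int_{Q_T}\varphi\, g\,\mathrm dx\,\mathrm dt=\langle\varphi_1,w(\cdot,0)\rangle_{H^{-1}_{(0)}(\Omega),H^1_{(0)}(\Omega)}-\int_\Omega\varphi_0(x)\,\partial_t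 w(x,0)\,\mathrm dx\qquad\text{for all } g\in L^2(Q_T),$$ where $w\in C^0([0,T];H^1_{(0)}(\Omega))\cap C^1([0,T];L^2(\Omega))\cap H^2(0,T;H^{-1}_{(0)}(\Omega))$ is the weak solution of the backward problem $\partial_{tt}w-\partial_{xx}w+Aw=g$ in $Q_T$, $w(0,\cdot)=0$, $\partial_xw(1,\cdot)=0$ on $(0,T)$, $(w,\partial_tw)(\cdot,T)=(0,0)$ in $\Omega$, i.e. $w(\cdot,T)=0$, $\partial_tw(\cdot,T)=0$ and, for a.e. $t\in(0,T)$ and all $z\in H^1_{(0)}(\Omega)$, $$\langle\partial_{tt}w(\cdot,t),z\rangle_{H^{-1}_{(0)}(\Omega),H^1_{(0)}(\Omega)}+\int_\Omega\partial_xw\,\partial_xz\,\mathrm dx+\int_\Omega A\,w\,z\,\mathrm dx=\int_\Omega g\,z\,\mathrm dx .$$ Then the trace $\varphi(1,\cdot)$ exists and belongs to $L^2(0,T)$, in the sense that $\varphi$ coincides almost everywhere in $Q_T$ with an element $x\mapsto\Phi(x)$ of $C^0([0,1];L^2(0,T))$, and $\varphi(1,\cdot):=\Phi(1)$. Moreover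 $$\|\varphi(1,\cdot)\|_{L^2(0,T)}\le C\,e^{C\sqrt{\|A\|_{L^\infty(Q_T)}}}\left(\|\varphi_0\|_{L^2(\Omega)}^2+\|\varphi_1\|_{H^{-1}_{(0)}(\Omega)}^2\right)^{1/2}.$$ -/

import Mathlib

noncomputable section

namespace HiddenReg

open MeasureTheory Set
open scoped ContDiff

/-- Lebesgue measure on `Ω = (0,1)`. -/
abbrev muOmega : Measure ℝ := volume.restrict (Ioo (0 : ℝ) 1)

/-- The space-time cylinder `Q_T = (0,1) × (0,T)`; points are written `(x, t)`. -/
abbrev cyl (T : ℝ) : Set (ℝ × ℝ) := Ioo (0 : ℝ) 1 ×ˢ Ioo (0 : ℝ) T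

/-- `L²(Ω)`. -/
abbrev L2Omega : Type := Lp ℝ 2 muOmega

/-- `L²(0,T)`. -/
abbrev L2Time (T : ℝ) : Type := Lp ℝ 2 (volume.restrict (Ioo (0 : ℝ) T))

/-- `L²(Q_T)`. -/
abbrev L2Cyl (T : ℝ) : Type := Lp ℝ 2 (volume.restrict (cyl T))

/-- `L^∞(Q_T)`. -/
abbrev LinfCyl (T : ℝ) : Type := Lp ℝ ⊤ (volume.restrict (cyl T))

/-- `v` is the weak derivative of `u` on `Ω = (0,1)`. -/
def IsWeakDeriv (u v : L2Omega) : Prop :=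
  ∀ ψ : ℝ → ℝ, ContDiff ℝ ∞ ψ → HasCompactSupport ψ → tsupport ψ ⊆ Ioo (0 : ℝ) 1 →
    ∫ x in Ioo (0 : ℝ) 1, u x * deriv ψ x = -∫ x in Ioo (0 : ℝ) 1, v x * ψ x

/-- The boundary condition `u(0) = 0`, read on the continuous representative of `u` on `[0,1]`. -/
def VanishesAtZero (u : L2Omega) : Prop :=
  ∃ f : ℝ → ℝ, ContinuousOn f (Icc 0 1) ∧ f 0 = 0 ∧ u =ᵐ[muOmega] f

theorem integrable_mul_of_bound (u : L2Omega) {f : ℝ → ℝ} (hf : Continuous f)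
    (hc : HasCompactSupport f) : Integrable (fun x => u x * f x) muOmega := by
  have h1 : Integrable u muOmega := (Lp.memLp u).integrable (by norm_num)
  obtain ⟨C, hC⟩ := hf.bounded_above_of_compact_support hc
  exact h1.mul_bdd (c := C) hf.aestronglyMeasurable (Filter.Eventually.of_forall hC)

theorem isWeakDeriv_add {u v u' v' : L2Omega} (h : IsWeakDeriv u u') (k : IsWeakDeriv v v') :
    IsWeakDeriv (u + v) (u' + v') := by
  intro ψ h1 h2 h3
  have hd : Continuous (deriv ψ) := h1.continuous_deriv (by simp)
  have e1 : ∫ x in Ioo (0 : ℝ) 1, (u + v : L2Omega) x * deriv ψ x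
      = ∫ x in Ioo (0 : ℝ) 1, (u x * deriv ψ x + v x * deriv ψ x) := by
    refine integral_congr_ae ?_
    filter_upwards [Lp.coeFn_add u v] with x hx
    rw [hx, Pi.add_apply, add_mul]
  have e2 : ∫ x in Ioo (0 : ℝ) 1, (u' + v' : L2Omega) x * ψ x
      = ∫ x in Ioo (0 : ℝ) 1, (u' x * ψ x + v' x * ψ x) := by
    refine integral_congr_ae ?_
    filter_upwards [Lp.coeFn_add u' v'] with x hx
    rw [hx, Pi.add_apply, add_mul]
  rw [e1, e2, integral_add (integrable_mul_of_bound u hd h2.deriv)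
    (integrable_mul_of_bound v hd h2.deriv), integral_add
    (integrable_mul_of_bound u' h1.continuous h2) (integrable_mul_of_bound v' h1.continuous h2),
    h ψ h1 h2 h3, k ψ h1 h2 h3]
  ring

theorem isWeakDeriv_smul (c : ℝ) {u u' : L2Omega} (h : IsWeakDeriv u u') :
    IsWeakDeriv (c • u) (c • u') := by
  intro ψ h1 h2 h3
  have e1 : ∫ x in Ioo (0 : ℝ) 1, (c • u : L2Omega) x * deriv ψ x
      = ∫ x in Ioo (0 : ℝ) 1, c * (u x * deriv ψ x) := by
    refine integral_congr_ae ?_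
    filter_upwards [Lp.coeFn_smul c u] with x hx
    rw [hx, Pi.smul_apply, smul_eq_mul, mul_assoc]
  have e2 : ∫ x in Ioo (0 : ℝ) 1, (c • u' : L2Omega) x * ψ x
      = ∫ x in Ioo (0 : ℝ) 1, c * (u' x * ψ x) := by
    refine integral_congr_ae ?_
    filter_upwards [Lp.coeFn_smul c u'] with x hx
    rw [hx, Pi.smul_apply, smul_eq_mul, mul_assoc]
  rw [e1, e2, integral_const_mul, integral_const_mul, h ψ h1 h2 h3]
  ring

theorem isWeakDeriv_zero : IsWeakDeriv 0 0 := by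
  simpa using isWeakDeriv_smul 0 (u := 0) (u' := 0) (fun ψ _ _ _ => by
    have e : ∀ f : ℝ → ℝ, ∫ x in Ioo (0 : ℝ) 1, (0 : L2Omega) x * f x = 0 := fun f => by
      refine integral_eq_zero_of_ae ?_
      filter_upwards [Lp.coeFn_zero ℝ 2 muOmega] with x hx
      simp only [hx, Pi.zero_apply, zero_mul]
    rw [e, e, neg_zero])

theorem exists_primitive {h : ℝ → ℝ} (h1 : ContDiff ℝ ∞ h) (h2 : HasCompactSupport h)
    (h3 : tsupport h ⊆ Ioo (0 : ℝ) 1) (h4 : ∫ x, h x = 0) :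
    ∃ ψ : ℝ → ℝ, ContDiff ℝ ∞ ψ ∧ HasCompactSupport ψ ∧ tsupport ψ ⊆ Ioo (0 : ℝ) 1 ∧
      deriv ψ = h := by
  obtain ⟨a, b, ha, hb, hab⟩ : ∃ a b : ℝ, 0 < a ∧ b < 1 ∧ tsupport h ⊆ Icc a b := by
    rcases (tsupport h).eq_empty_or_nonempty with he | hne
    · exact ⟨1 / 2, 1 / 2, by norm_num, by norm_num, by simp [he]⟩
    · obtain ⟨a, ha, ha'⟩ := h2.isCompact.exists_isLeast hne
      obtain ⟨b, hb, hb'⟩ := h2.isCompact.exists_isGreatest hne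
      exact ⟨a, b, (h3 ha).1, (h3 hb).2, fun x hx => ⟨ha' hx, hb' hx⟩⟩
  have hz : ∀ x, x ∉ Icc a b → h x = 0 := fun x hx => image_eq_zero_of_notMem_tsupport
    (fun k => hx (hab k))
  have hd : ∀ x, HasDerivAt (fun x => ∫ s in (0 : ℝ)..x, h s) (h x) x := fun x =>
    intervalIntegral.integral_hasDerivAt_right (h1.continuous.intervalIntegrable _ _)
      (h1.continuous.stronglyMeasurableAtFilter _ _) h1.continuous.continuousAt
  have hde : deriv (fun x => ∫ s in (0 : ℝ)..x, h s) = h := funext fun x => (hd x).deriv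
  have hz0 : ∀ x, x ∉ Icc a b → ∫ s in (0 : ℝ)..x, h s = 0 := by
    intro x hx
    by_cases hxa : x < a
    · have : ∀ s ∈ uIcc 0 x, h s = 0 := by
        intro s hs
        refine hz s fun k => ?_
        have := hs.2
        have h5 : max 0 x < a := max_lt ha hxa
        linarith [k.1]
      rw [intervalIntegral.integral_congr (g := fun _ => 0) this]
      simp
    · have hbx : b < x := by
        by_contra hc
        exact hx ⟨not_lt.1 hxa, not_lt.1 hc⟩
      have hx0 : 0 ≤ x := by linarith [not_lt.1 hxa]
      rw [intervalIntegral.integral_of_le hx0, setIntegral_eq_integral_of_forall_compl_eq_zero, h4]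
      intro s hs
      refine hz s fun k => hs ⟨by linarith [k.1], by linarith [k.2]⟩
  have hts : tsupport (fun x => ∫ s in (0 : ℝ)..x, h s) ⊆ Icc a b :=
    closure_minimal (fun x hx => by
      by_contra hc
      exact hx (hz0 x hc)) isClosed_Icc
  refine ⟨fun x => ∫ s in (0 : ℝ)..x, h s, ?_, ?_, hts.trans fun x hx => ⟨by linarith [hx.1],
    by linarith [hx.2]⟩, hde⟩
  · rw [contDiff_infty_iff_deriv, hde]
    exact ⟨fun x => (hd x).differentiableAt, h1⟩
  · exact isCompact_Icc.of_isClosed_subset (isClosed_tsupport _) hts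

theorem eq_zero_of_isWeakDeriv_zero {u : L2Omega} (h : IsWeakDeriv u 0) (hv : VanishesAtZero u) :
    u = 0 := by
  have hu : Integrable u muOmega := (Lp.memLp u).integrable (by norm_num)
  let η : ContDiffBump (1 / 2 : ℝ) := ⟨1 / 8, 1 / 4, by norm_num, by norm_num⟩
  have n1 : ContDiff ℝ ∞ (η.normed volume) := η.contDiff_normed
  have n2 : HasCompactSupport (η.normed volume) := η.hasCompactSupport_normed
  have n3 : tsupport (η.normed volume) ⊆ Ioo (0 : ℝ) 1 := by
    rw [η.tsupport_normed_eq, Real.closedBall_eq_Icc]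
    intro x hx
    have h1 := hx.1
    have h2 := hx.2
    simp only [η] at h1 h2
    exact ⟨by linarith, by linarith⟩
  set c : ℝ := ∫ x in Ioo (0 : ℝ) 1, u x * η.normed volume x with hc
  have key : ∀ g : ℝ → ℝ, ContDiff ℝ ∞ g → HasCompactSupport g → tsupport g ⊆ Ioo (0 : ℝ) 1 →
      ∫ x in Ioo (0 : ℝ) 1, g x • (u x - c) = 0 := by
    intro g g1 g2 g3
    set m : ℝ := ∫ x, g x with hm
    have gi : Integrable g := g1.continuous.integrable_of_hasCompactSupport g2
    have ni : Integrable (η.normed volume) := n1.continuous.integrable_of_hasCompactSupport n2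
    have ts : tsupport (fun x => g x - m * η.normed volume x) ⊆ tsupport g ∪
        tsupport (η.normed volume) := by
      refine closure_minimal (fun x hx => ?_)
        ((isClosed_tsupport _).union (isClosed_tsupport _))
      by_contra hcon
      rw [mem_union, not_or] at hcon
      refine hx ?_
      simp only [image_eq_zero_of_notMem_tsupport hcon.1,
        image_eq_zero_of_notMem_tsupport hcon.2, mul_zero, sub_zero]
    obtain ⟨ψ, p1, p2, p3, p4⟩ := exists_primitive (h := fun x => g x - m * η.normed volume x)
      (g1.sub (contDiff_const.mul n1))
      ((g2.isCompact.union n2.isCompact).of_isClosed_subset (isClosed_tsupport _) ts)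
      (ts.trans (union_subset g3 n3))
      (by rw [integral_sub gi (ni.const_mul m), integral_const_mul, η.integral_normed]; simp [hm])
    have e := h ψ p1 p2 p3
    have z0 : ∫ x in Ioo (0 : ℝ) 1, (0 : L2Omega) x * ψ x = 0 := by
      refine integral_eq_zero_of_ae ?_
      filter_upwards [Lp.coeFn_zero ℝ 2 muOmega] with x hx
      simp only [hx, Pi.zero_apply, zero_mul]
    have i1 : Integrable (fun x => u x * g x) muOmega :=
      integrable_mul_of_bound u g1.continuous g2
    have i2 : Integrable (fun x => u x * η.normed volume x) muOmega :=
      integrable_mul_of_bound u n1.continuous n2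
    have mg : ∫ x in Ioo (0 : ℝ) 1, g x = m :=
      setIntegral_eq_integral_of_forall_compl_eq_zero fun x hx =>
        image_eq_zero_of_notMem_tsupport fun k => hx (g3 k)
    have e2 : (∫ x in Ioo (0 : ℝ) 1, u x * g x) - m * c = 0 := by
      rw [z0, neg_zero, p4] at e
      refine Eq.trans ?_ e
      rw [hc, ← integral_const_mul, ← integral_sub i1 (i2.const_mul m)]
      refine integral_congr_ae (Filter.Eventually.of_forall fun x => ?_)
      simp only
      ring
    refine Eq.trans ?_ e2
    rw [← mg, ← integral_mul_const, ← integral_sub i1 (gi.restrict.mul_const c)]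
    refine integral_congr_ae (Filter.Eventually.of_forall fun x => ?_)
    simp only [smul_eq_mul]
    ring
  have hae : ∀ᵐ x ∂muOmega, x ∈ Ioo (0 : ℝ) 1 → u x - c = 0 :=
    isOpen_Ioo.ae_eq_zero_of_integral_contDiff_smul_eq_zero
      ((hu.sub (integrable_const c)).locallyIntegrable.locallyIntegrableOn _) key
  have huc : ∀ᵐ x ∂muOmega, u x = c := by
    filter_upwards [hae, ae_restrict_mem measurableSet_Ioo] with x h1 h2
    exact sub_eq_zero.1 (h1 h2)
  obtain ⟨f, hf, hf0, huf⟩ := hv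
  have hfc : f =ᵐ[volume.restrict (Icc (0 : ℝ) 1)] fun _ => c := by
    rw [← Measure.restrict_congr_set (Ioo_ae_eq_Icc (μ := volume) (a := (0 : ℝ)) (b := 1))]
    filter_upwards [huc, huf] with x h1 h2
    rw [← h2, h1]
  have h0 := Measure.eqOn_Icc_of_ae_eq volume (by norm_num) hfc hf continuousOn_const
    (left_mem_Icc.2 zero_le_one)
  have hc0 : c = 0 := by rw [← hf0]; exact h0.symm
  refine Lp.ext ?_
  filter_upwards [huc, Lp.coeFn_zero ℝ 2 muOmega] with x h1 h2
  rw [h1, h2, hc0, Pi.zero_apply]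

/-- The graph of the weak derivative over `{z ∈ H¹(Ω) : z(0) = 0}`: the pairs `(z, ∂ₓz)`. -/
def h1ZeroGraph : Submodule ℝ (L2Omega × L2Omega) where
  carrier := {p | IsWeakDeriv p.1 p.2 ∧ VanishesAtZero p.1}
  add_mem' := by
    rintro p q ⟨hp, f, hf, hf0, hpf⟩ ⟨hq, g, hg, hg0, hqg⟩
    refine ⟨isWeakDeriv_add hp hq, f + g, hf.add hg, by simp [hf0, hg0], ?_⟩
    exact (Lp.coeFn_add p.1 q.1).trans (hpf.add hqg)
  zero_mem' := ⟨isWeakDeriv_zero, 0, continuousOn_const, rfl, Lp.coeFn_zero ℝ 2 muOmega⟩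
  smul_mem' := by
    rintro c p ⟨hp, f, hf, hf0, hpf⟩
    refine ⟨isWeakDeriv_smul c hp, c • f, hf.const_smul c, by simp [hf0], ?_⟩
    exact (Lp.coeFn_smul c p.1).trans (hpf.const_smul c)

/-- The space `H¹₍₀₎(Ω) = {z ∈ H¹(Ω) : z(0) = 0}`. An element is stored together with its weak
derivative, which it determines. -/
def H1Zero : Type := h1ZeroGraph

instance : AddCommGroup H1Zero := inferInstanceAs (AddCommGroup h1ZeroGraph)

instance : Module ℝ H1Zero := inferInstanceAs (Module ℝ h1ZeroGraph)

/-- The inclusion `H¹₍₀₎(Ω) → L²(Ω)`. -/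
def H1Zero.toL2 : H1Zero →ₗ[ℝ] L2Omega :=
  (LinearMap.fst ℝ L2Omega L2Omega).comp h1ZeroGraph.subtype

/-- The derivative `∂ₓ : H¹₍₀₎(Ω) → L²(Ω)`. -/
def H1Zero.dx : H1Zero →ₗ[ℝ] L2Omega :=
  (LinearMap.snd ℝ L2Omega L2Omega).comp h1ZeroGraph.subtype

theorem H1Zero.dx_injective : Function.Injective H1Zero.dx := by
  rw [injective_iff_map_eq_zero]
  rintro ⟨⟨u, v⟩, hw, hv⟩ h
  have h' : v = 0 := h
  subst h'
  have hu : u = 0 := eq_zero_of_isWeakDeriv_zero hw hv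
  subst hu
  rfl

/-- `H¹₍₀₎(Ω)` carries the norm `‖z‖ = ‖∂ₓz‖_{L²(Ω)}`. -/
instance : NormedAddCommGroup H1Zero :=
  NormedAddCommGroup.induced H1Zero L2Omega H1Zero.dx H1Zero.dx_injective

instance : NormedSpace ℝ H1Zero := NormedSpace.induced ℝ H1Zero L2Omega H1Zero.dx

/-- `H⁻¹₍₀₎(Ω)`, the dual space of `H¹₍₀₎(Ω)` with the dual norm. -/
abbrev HNegOne : Type := StrongDual ℝ H1Zero

/-- `w` is the weak solution on `(0,T)` of the backward problem
`∂ₜₜw - ∂ₓₓw + A w = g` in `Q_T`, `w(0,·) = 0`, `∂ₓw(1,·) = 0`, `(w, ∂ₜw)(·,T) = (0,0)`,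
in the class `C⁰([0,T]; H¹₍₀₎) ∩ C¹([0,T]; L²) ∩ H²(0,T; H⁻¹₍₀₎)`; `w'` is `∂ₜw`. -/
structure IsBackwardWeakSolution (T : ℝ) (A : LinfCyl T) (g : L2Cyl T)
    (w : ℝ → H1Zero) (w' : ℝ → L2Omega) : Prop where
  continuousOn : ContinuousOn w (Icc 0 T)
  hasDeriv : ∀ t ∈ Icc 0 T, HasDerivWithinAt (fun s => (w s).toL2) (w' t) (Icc 0 T) t
  continuousOn_deriv : ContinuousOn w' (Icc 0 T)
  /-- `w''` is the second time derivative `∂ₜₜw ∈ L²(0,T; H⁻¹₍₀₎)`: as an `H⁻¹₍₀₎`-valued function,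
  `∂ₜw` is a primitive of `w''`. The equation holds in variational form for a.e. `t`. -/
  equation : ∃ w'' : ℝ → HNegOne, MemLp w'' 2 (volume.restrict (Ioo 0 T)) ∧
    (∀ t ∈ Icc 0 T, ∀ z : H1Zero,
      ∫ x in Ioo (0 : ℝ) 1, w' t x * z.toL2 x
        = (∫ x in Ioo (0 : ℝ) 1, w' 0 x * z.toL2 x) + (∫ s in (0 : ℝ)..t, w'' s) z) ∧
    ∀ᵐ t ∂(volume.restrict (Ioo 0 T)), ∀ z : H1Zero,
      w'' t z + (∫ x in Ioo (0 : ℝ) 1, (w t).dx x * z.dx x)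
          + (∫ x in Ioo (0 : ℝ) 1, A (x, t) * (w t).toL2 x * z.toL2 x)
        = ∫ x in Ioo (0 : ℝ) 1, g (x, t) * z.toL2 x
  final : w T = 0
  final_deriv : w' T = 0

/-- `φ ∈ L²(Q_T)` is a solution in the sense of transposition of
`∂ₜₜφ - ∂ₓₓφ + A φ = B` in `Q_T`, `φ(0,·) = 0`, `∂ₓφ(1,·) = 0`, `(φ, ∂ₜφ)(·,0) = (φ₀, φ₁)`. -/
def IsTranspositionSolution (T : ℝ) (A : LinfCyl T) (B : L2Cyl T)
    (φ₀ : L2Omega) (φ₁ : HNegOne) (φ : L2Cyl T) : Prop :=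
  ∀ (g : L2Cyl T) (w : ℝ → H1Zero) (w' : ℝ → L2Omega), IsBackwardWeakSolution T A g w w' →
    ∫ p in cyl T, φ p * g p
      = (∫ t in Ioo (0 : ℝ) T, ∫ x in Ioo (0 : ℝ) 1, B (x, t) * (w t).toL2 x)
        + φ₁ (w 0) - ∫ x in Ioo (0 : ℝ) 1, φ₀ x * w' 0 x

/-- `θ ∈ L²(0,T)` is the trace `φ(1,·)` of `φ ∈ L²(Q_T)`: `φ` coincides almost everywhere with some
`Φ ∈ C⁰([0,1]; L²(0,T))`, `x ↦ φ(x,·)`, and `θ = Φ(1)`. -/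
def IsTraceAtOne (T : ℝ) (φ : L2Cyl T) (θ : L2Time T) : Prop :=
  ∃ Φ : ℝ → L2Time T, ContinuousOn Φ (Icc 0 1) ∧
    (∀ᵐ x ∂muOmega, Φ x =ᵐ[volume.restrict (Ioo 0 T)] fun t => φ (x, t)) ∧ Φ 1 = θ

end HiddenReg

end

noncomputable section

namespace HiddenReg

open MeasureTheory Set
open scoped ContDiff

/-! The operator -∂ₓₓ with z(0) = 0 and ∂ₓz(1) = 0 has the eigenfunctions `mode k`, with eigenvalues
`freq k ^ 2`, and they are complete in L²(Ω). Testing the transposition identity with separated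
backward solutions θ(t) eₖ(x) shows (`coeff_ae_eq`) that the k-th coefficient of φ is a free
oscillation fixed by the data minus a Duhamel integral of the k-th coefficient of Aφ. These explicit
test functions suffice; no general theory of the backward problem enters.

Write ω = `freq k`. Two bounds on the Duhamel kernel sin(ωr)/ω do different work. The bound by r is
uniform in k. In L²(0,T) with weight exp(-2lt) it gives the Duhamel operator a norm of at most 1/l²
(`integral_exp_mul_duhamel_sq_le`). With l² = 2‖A‖ + 1 the potential term is absorbed, which bounds
‖φ‖² by the data times exp(2lT) (`norm_sq_le_of_isTranspositionSolution`). The gain l⁻², instead of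
l⁻¹, is the source of √‖A‖ in the exponent. The bound by 1/ω decays in k. Since ∑ 1/ω² converges,
Cauchy-Schwarz controls the sum of the Duhamel parts at every fixed x.

The free part has no such decay; there orthogonality in time replaces it. Sums and differences of
the frequencies are integer multiples of π, so the free coefficients are mutually orthogonal on
(0,2m). Enlarging (0,T) to such an interval bounds their sum at a fixed x by the data, because
|eₖ(x)| ≤ √2. This is the hidden regularity.

Both bounds are uniform in x (`norm_sq_sum_mode_smul_le`), so the expansion converges uniformly on
[0,1] to a continuous L²(0,T)-valued function, which Parseval's identity in Q_T identifies with φ.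
The energy estimate then removes ‖φ‖ from the trace bound, and `one_add_sq_mul_exp_le` puts the
constant in the required form. -/

/-! ### Primitives on an interval and Fubini on a triangle. -/

theorem integrableOn_Icc_of_Ioo {v : ℝ → ℝ} {L : ℝ} (hv : IntegrableOn v (Ioo 0 L)) :
    IntegrableOn v (Icc 0 L) :=
  (integrableOn_Icc_iff_integrableOn_Ioo (by simp) (by simp)).2 hv

theorem intervalIntegrable_of_Ioo {v : ℝ → ℝ} {L a b : ℝ} (hv : IntegrableOn v (Ioo 0 L))
    (ha : a ∈ Icc 0 L) (hb : b ∈ Icc 0 L) : IntervalIntegrable v volume a b :=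
  ((integrableOn_Icc_of_Ioo hv).mono_set (uIcc_subset_Icc ha hb)).intervalIntegrable

theorem continuousOn_primitive_of_Ioo {v : ℝ → ℝ} {L : ℝ} (hL : 0 ≤ L)
    (hv : IntegrableOn v (Ioo 0 L)) : ContinuousOn (fun x => ∫ s in (0 : ℝ)..x, v s) (Icc 0 L) := by
  have := intervalIntegral.continuousOn_primitive_interval (f := v) (μ := volume) (a := 0) (b := L)
    (by rw [uIcc_of_le hL]; exact integrableOn_Icc_of_Ioo hv)
  rwa [uIcc_of_le hL] at this

theorem memLp_of_continuousOn {E : Type*} [NormedAddCommGroup E] {f : ℝ → E} {a b : ℝ}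
    (hf : ContinuousOn f (Icc a b)) {p : ENNReal} :
    MemLp f p (volume.restrict (Ioo a b)) := by
  obtain ⟨C, hC⟩ := isCompact_Icc.exists_bound_of_continuousOn hf
  refine MemLp.of_bound ((hf.mono Ioo_subset_Icc_self).aestronglyMeasurable measurableSet_Ioo) C ?_
  filter_upwards [ae_restrict_mem measurableSet_Ioo] with x hx
  exact hC x (Ioo_subset_Icc_self hx)

/-- Fubini on the triangle `0 < s < x < L`. -/
theorem integral_triangle_swap {L : ℝ} {v : ℝ → ℝ} (hv : IntegrableOn v (Ioo 0 L))
    {c : ℝ → ℝ → ℝ} (hc : Continuous (Function.uncurry c)) :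
    IntegrableOn (fun x => ∫ s in (0 : ℝ)..x, c x s * v s) (Ioo 0 L) ∧
    ∫ x in Ioo 0 L, ∫ s in (0 : ℝ)..x, c x s * v s
      = ∫ s in Ioo 0 L, (∫ x in s..L, c x s) * v s := by
  have hint : Integrable (Function.uncurry fun x s => (Ioi s).indicator (fun x => c x s * v s) x)
      ((volume.restrict (Ioo 0 L)).prod (volume.restrict (Ioo 0 L))) := by
    have h1 : Integrable (fun p : ℝ × ℝ => v p.2)
        ((volume.restrict (Ioo 0 L)).prod (volume.restrict (Ioo 0 L))) := by
      exact Integrable.comp_snd (ν := volume.restrict (Ioo 0 L)) hv (volume.restrict (Ioo 0 L))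
    obtain ⟨C, hC⟩ := (isCompact_Icc (a := (0 : ℝ)) (b := L)).prod
      (isCompact_Icc (a := (0 : ℝ)) (b := L)) |>.exists_bound_of_continuousOn hc.continuousOn
    have h2 : Integrable (fun p : ℝ × ℝ => Function.uncurry c p * v p.2)
        ((volume.restrict (Ioo 0 L)).prod (volume.restrict (Ioo 0 L))) := by
      refine h1.bdd_mul (c := C) hc.aestronglyMeasurable ?_
      rw [Measure.prod_restrict]
      filter_upwards [ae_restrict_mem (measurableSet_Ioo.prod measurableSet_Ioo)] with p hp
      exact hC p ⟨Ioo_subset_Icc_self hp.1, Ioo_subset_Icc_self hp.2⟩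
    have h3 := h2.indicator (s := {p : ℝ × ℝ | p.2 < p.1})
      (measurableSet_lt measurable_snd measurable_fst)
    refine h3.congr (Filter.Eventually.of_forall fun p => ?_)
    simp only [indicator, mem_ofPred_eq, Function.uncurry, mem_Ioi]
  have key := integral_integral_swap hint
  have e1 : EqOn (fun x => ∫ s in (0 : ℝ)..x, c x s * v s)
      (fun x => ∫ s in Ioo 0 L, (Ioi s).indicator (fun x => c x s * v s) x) (Ioo 0 L) := by
    intro x hx
    have : (fun s => (Ioi s).indicator (fun x => c x s * v s) x)
        = (Iio x).indicator fun s => c x s * v s := by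
      ext s
      simp only [indicator, mem_Ioi, mem_Iio]
    simp only [this]
    rw [setIntegral_indicator measurableSet_Iio, intervalIntegral.integral_of_le hx.1.le,
      integral_Ioc_eq_integral_Ioo]
    congr 2
    ext s
    simp only [mem_Ioo, mem_inter_iff, mem_Iio]
    constructor
    · exact fun h => ⟨⟨h.1, h.2.trans hx.2⟩, h.2⟩
    · exact fun h => ⟨h.1.1, h.2⟩
  have e2 : ∫ s in Ioo 0 L, (∫ x in s..L, c x s) * v s
      = ∫ s in Ioo 0 L, ∫ x in Ioo 0 L, (Ioi s).indicator (fun x => c x s * v s) x := by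
    refine setIntegral_congr_fun measurableSet_Ioo fun s hs => ?_
    rw [setIntegral_indicator measurableSet_Ioi, ← intervalIntegral.integral_mul_const,
      intervalIntegral.integral_of_le hs.2.le, integral_Ioc_eq_integral_Ioo]
    congr 2
    ext x
    simp only [mem_Ioo, mem_inter_iff, mem_Ioi]
    constructor
    · exact fun h => ⟨⟨hs.1.trans h.1, h.2⟩, h.1⟩
    · exact fun h => ⟨h.2, h.1.2⟩
  refine ⟨IntegrableOn.congr_fun hint.integral_prod_left e1.symm measurableSet_Ioo, ?_⟩
  rw [setIntegral_congr_fun measurableSet_Ioo e1, e2]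
  exact key

/-! ### Elements of H¹₍₀₎(Ω) as primitives. -/

theorem integrable_L2Omega (u : L2Omega) : Integrable u muOmega :=
  (Lp.memLp u).integrable (by norm_num)

/-- Elements of `H¹₍₀₎` are the primitives of their derivatives. -/
theorem H1Zero.toL2_ae_eq (z : H1Zero) :
    z.toL2 =ᵐ[muOmega] fun x => ∫ s in (0 : ℝ)..x, z.dx s := by
  have hv : IntegrableOn (z.dx : ℝ → ℝ) (Ioo 0 1) := integrable_L2Omega z.dx
  have hZ := continuousOn_primitive_of_Ioo zero_le_one hv
  have hm : MemLp (fun x => ∫ s in (0 : ℝ)..x, z.dx s) 2 muOmega := memLp_of_continuousOn hZ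
  have hZe : hm.toLp =ᵐ[muOmega] fun x => ∫ s in (0 : ℝ)..x, z.dx s := hm.coeFn_toLp
  have hw : IsWeakDeriv hm.toLp z.dx := by
    intro ψ h1 h2 h3
    have hd : Continuous (deriv ψ) := h1.continuous_deriv (by simp)
    have e1 : ∫ x in Ioo (0 : ℝ) 1, (hm.toLp : L2Omega) x * deriv ψ x
        = ∫ x in Ioo (0 : ℝ) 1, ∫ s in (0 : ℝ)..x, deriv ψ x * z.dx s := by
      refine integral_congr_ae ?_
      filter_upwards [hZe] with x hx
      rw [hx, intervalIntegral.integral_const_mul, mul_comm]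
    have hψ1 : ψ 1 = 0 := image_eq_zero_of_notMem_tsupport fun k => (lt_irrefl _ (h3 k).2)
    rw [e1, (integral_triangle_swap hv (c := fun x _ => deriv ψ x) (hd.comp continuous_fst)).2,
      ← integral_neg]
    refine integral_congr_ae (Filter.Eventually.of_forall fun s => ?_)
    simp only
    rw [intervalIntegral.integral_deriv_eq_sub
      (fun x _ => (h1.differentiable (by simp)).differentiableAt) (hd.intervalIntegrable _ _), hψ1]
    ring
  -- The primitive of ∂ₓz vanishes at 0 and has the same weak derivative as z, so injectivity of ∂ₓ
  -- identifies the two.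
  have hmem : ((hm.toLp, z.dx) : L2Omega × L2Omega) ∈ h1ZeroGraph :=
    ⟨hw, _, hZ, by simp, hZe⟩
  have : (⟨_, hmem⟩ : H1Zero) = z := H1Zero.dx_injective rfl
  have h2 : z.toL2 = hm.toLp := (congrArg H1Zero.toL2 this).symm
  rw [h2]
  exact hZe

/-- Integration by parts on `H¹₍₀₎` against a function whose derivative is `-p` and which vanishes
at `1`. -/
theorem H1Zero.integral_dx_mul (z : H1Zero) {P p : ℝ → ℝ} (hp : Continuous p)
    (hP : ∀ x, HasDerivAt P (-p x) x) (hP1 : P 1 = 0) :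
    ∫ x in Ioo (0 : ℝ) 1, P x * z.dx x = ∫ x in Ioo (0 : ℝ) 1, p x * z.toL2 x := by
  have e1 : ∫ x in Ioo (0 : ℝ) 1, p x * z.toL2 x
      = ∫ x in Ioo (0 : ℝ) 1, ∫ s in (0 : ℝ)..x, p x * z.dx s := by
    refine integral_congr_ae ?_
    filter_upwards [z.toL2_ae_eq] with x hx
    rw [hx, intervalIntegral.integral_const_mul]
  rw [e1, (integral_triangle_swap (integrable_L2Omega z.dx) (c := fun x _ => p x)
    (hp.comp continuous_fst)).2]
  refine integral_congr_ae (Filter.Eventually.of_forall fun s => ?_)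
  have : ∫ x in s..1, p x = -∫ x in s..1, -p x := by rw [intervalIntegral.integral_neg, neg_neg]
  simp only
  rw [this, intervalIntegral.integral_eq_sub_of_hasDerivAt (fun x _ => hP x)
    (hp.neg.intervalIntegrable _ _), hP1]
  ring

/-! ### Orthogonality in time of the oscillations with half-integer frequencies. -/

theorem integral_cos_int_mul_pi (n : ℤ) (m : ℕ) :
    ∫ t in (0 : ℝ)..m, Real.cos (n * Real.pi * t) = if n = 0 then (m : ℝ) else 0 := by
  split_ifs with h
  · simp [h]
  · have hc : (n * Real.pi : ℝ) ≠ 0 := mul_ne_zero (by exact_mod_cast h) Real.pi_ne_zero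
    rw [intervalIntegral.integral_comp_mul_left (fun x => Real.cos x) hc, integral_cos]
    have : (n * Real.pi * m : ℝ) = ((n * m : ℤ) : ℝ) * Real.pi := by push_cast; ring
    rw [this, Real.sin_int_mul_pi]
    simp

/-- The length must be even: cos(nπt) returns to 1 after time 2, but for odd n not after time 1.
This is why the trace estimate compares T with 2m. -/
theorem integral_sin_int_mul_pi (n : ℤ) (m : ℕ) :
    ∫ t in (0 : ℝ)..(2 * m : ℕ), Real.sin (n * Real.pi * t) = 0 := by
  by_cases h : n = 0
  · simp [h]
  · have hc : (n * Real.pi : ℝ) ≠ 0 := mul_ne_zero (by exact_mod_cast h) Real.pi_ne_zero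
    rw [intervalIntegral.integral_comp_mul_left (fun x => Real.sin x) hc, integral_sin]
    have : (n * Real.pi * (2 * m : ℕ) : ℝ) = ((n * m : ℤ) : ℝ) * (2 * Real.pi) := by
      push_cast; ring
    rw [this, Real.cos_int_mul_two_pi]
    simp

/-- The frequencies `(k + 1/2) π` of the mixed Dirichlet-Neumann problem on `(0,1)`. -/
def freq (k : ℕ) : ℝ := (k + 1 / 2) * Real.pi

theorem succ_le_freq (k : ℕ) : (k : ℝ) + 1 ≤ freq k := by
  unfold freq
  nlinarith [Real.pi_gt_three, (Nat.cast_nonneg k : (0 : ℝ) ≤ k)]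

theorem freq_pos (k : ℕ) : 0 < freq k :=
  lt_of_lt_of_le (by positivity) (succ_le_freq k)

theorem freq_ne_zero (k : ℕ) : freq k ≠ 0 := (freq_pos k).ne'

theorem cos_freq (k : ℕ) : Real.cos (freq k) = 0 := by
  rw [Real.cos_eq_zero_iff]
  exact ⟨k, by unfold freq; push_cast; ring⟩

theorem integral_cos_freq_sub (j k m : ℕ) :
    ∫ t in (0 : ℝ)..m, Real.cos (freq j * t - freq k * t) = if j = k then (m : ℝ) else 0 := by
  have := integral_cos_int_mul_pi (j - k) m
  simp only [sub_eq_zero, Nat.cast_inj] at this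
  rw [← this]
  congr 1; ext t; unfold freq; push_cast; ring_nf

/-- The sum of two half-integers is the integer j + k + 1, which is positive, so there is no
resonant case, unlike for the difference. -/
theorem integral_cos_freq_add (j k m : ℕ) :
    ∫ t in (0 : ℝ)..m, Real.cos (freq j * t + freq k * t) = 0 := by
  have := integral_cos_int_mul_pi (j + k + 1) m
  rw [if_neg (by omega)] at this
  rw [← this]
  congr 1; ext t; unfold freq; push_cast; ring_nf

theorem integral_sin_freq_add (j k m : ℕ) :
    ∫ t in (0 : ℝ)..(2 * m : ℕ), Real.sin (freq j * t + freq k * t) = 0 := by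
  refine Eq.trans ?_ (integral_sin_int_mul_pi (j + k + 1) m)
  congr 1; ext t; unfold freq; push_cast; ring_nf

theorem integral_sin_freq_sub (j k m : ℕ) :
    ∫ t in (0 : ℝ)..(2 * m : ℕ), Real.sin (freq j * t - freq k * t) = 0 := by
  refine Eq.trans ?_ (integral_sin_int_mul_pi (j - k) m)
  congr 1; ext t; unfold freq; push_cast; ring_nf

theorem integral_cos_mul_cos (j k m : ℕ) :
    ∫ t in (0 : ℝ)..m, Real.cos (freq j * t) * Real.cos (freq k * t)
      = if j = k then (m / 2 : ℝ) else 0 := by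
  have e : ∀ t, Real.cos (freq j * t) * Real.cos (freq k * t)
      = (1 / 2) * (Real.cos (freq j * t - freq k * t) + Real.cos (freq j * t + freq k * t)) := by
    intro t; rw [Real.cos_sub, Real.cos_add]; ring
  simp only [e]
  rw [intervalIntegral.integral_const_mul, intervalIntegral.integral_add
    (Continuous.intervalIntegrable (by fun_prop) _ _)
    (Continuous.intervalIntegrable (by fun_prop) _ _),
    integral_cos_freq_sub, integral_cos_freq_add]
  split_ifs <;> ring

theorem integral_sin_mul_sin (j k m : ℕ) :
    ∫ t in (0 : ℝ)..m, Real.sin (freq j * t) * Real.sin (freq k * t)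
      = if j = k then (m / 2 : ℝ) else 0 := by
  have e : ∀ t, Real.sin (freq j * t) * Real.sin (freq k * t)
      = (1 / 2) * (Real.cos (freq j * t - freq k * t) - Real.cos (freq j * t + freq k * t)) := by
    intro t; rw [Real.cos_sub, Real.cos_add]; ring
  simp only [e]
  rw [intervalIntegral.integral_const_mul, intervalIntegral.integral_sub
    (Continuous.intervalIntegrable (by fun_prop) _ _)
    (Continuous.intervalIntegrable (by fun_prop) _ _),
    integral_cos_freq_sub, integral_cos_freq_add]
  split_ifs <;> ring

theorem integral_cos_mul_sin (j k m : ℕ) :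
    ∫ t in (0 : ℝ)..(2 * m : ℕ), Real.cos (freq j * t) * Real.sin (freq k * t) = 0 := by
  have e : ∀ t, Real.cos (freq j * t) * Real.sin (freq k * t)
      = (1 / 2) * (Real.sin (freq j * t + freq k * t) - Real.sin (freq j * t - freq k * t)) := by
    intro t; rw [Real.sin_sub, Real.sin_add]; ring
  simp only [e]
  rw [intervalIntegral.integral_const_mul, intervalIntegral.integral_sub
    (Continuous.intervalIntegrable (by fun_prop) _ _)
    (Continuous.intervalIntegrable (by fun_prop) _ _),
    integral_sin_freq_sub, integral_sin_freq_add]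
  ring

/-! ### Eigenfunctions in L²(Ω) and their orthonormality. -/

/-- The normalized eigenfunctions `√2 sin ((k + 1/2) π x)`. -/
def mode (k : ℕ) (x : ℝ) : ℝ := √2 * Real.sin (freq k * x)

/-- The functions `√2 cos ((k + 1/2) π x)`. -/
def comode (k : ℕ) (x : ℝ) : ℝ := √2 * Real.cos (freq k * x)

@[fun_prop]
theorem continuous_mode (k : ℕ) : Continuous (mode k) := by unfold mode; fun_prop

@[fun_prop]
theorem continuous_comode (k : ℕ) : Continuous (comode k) := by unfold comode; fun_prop

theorem abs_mode_le (k : ℕ) (x : ℝ) : |mode k x| ≤ √2 := by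
  unfold mode
  rw [abs_mul, abs_of_nonneg (Real.sqrt_nonneg 2)]
  exact mul_le_of_le_one_right (Real.sqrt_nonneg 2) (Real.abs_sin_le_one _)

theorem hasDerivAt_mode (k : ℕ) (x : ℝ) : HasDerivAt (mode k) (freq k * comode k x) x := by
  have := (((hasDerivAt_id x).const_mul (freq k)).sin).const_mul (√2)
  refine this.congr_deriv ?_
  simp only [id, comode]; ring

theorem hasDerivAt_comode (k : ℕ) (x : ℝ) : HasDerivAt (comode k) (-(freq k * mode k x)) x := by
  have := (((hasDerivAt_id x).const_mul (freq k)).cos).const_mul (√2)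
  refine this.congr_deriv ?_
  simp only [id, mode]; ring

theorem memLp_mode (k : ℕ) : MemLp (mode k) 2 muOmega :=
  memLp_of_continuousOn (continuous_mode k).continuousOn

theorem memLp_comode (k : ℕ) : MemLp (comode k) 2 muOmega :=
  memLp_of_continuousOn (continuous_comode k).continuousOn

/-- The eigenfunctions as elements of `L²(Ω)`. -/
def modeL2 (k : ℕ) : L2Omega := (memLp_mode k).toLp

/-- The normalized derivatives of the eigenfunctions as elements of `L²(Ω)`. -/
def comodeL2 (k : ℕ) : L2Omega := (memLp_comode k).toLp

theorem modeL2_ae (k : ℕ) : modeL2 k =ᵐ[muOmega] mode k := (memLp_mode k).coeFn_toLp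

theorem comodeL2_ae (k : ℕ) : comodeL2 k =ᵐ[muOmega] comode k := (memLp_comode k).coeFn_toLp

theorem inner_L2Omega (u v : L2Omega) : inner ℝ u v = ∫ x in Ioo (0 : ℝ) 1, u x * v x := by
  rw [L2.inner_def]
  refine integral_congr_ae (Filter.Eventually.of_forall fun x => ?_)
  simp [mul_comm]

theorem inner_modeL2 (k : ℕ) (v : L2Omega) :
    inner ℝ (modeL2 k) v = ∫ x in Ioo (0 : ℝ) 1, mode k x * v x := by
  rw [inner_L2Omega]
  refine integral_congr_ae ?_
  filter_upwards [modeL2_ae k] with x hx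
  rw [hx]

theorem inner_comodeL2 (k : ℕ) (v : L2Omega) :
    inner ℝ (comodeL2 k) v = ∫ x in Ioo (0 : ℝ) 1, comode k x * v x := by
  rw [inner_L2Omega]
  refine integral_congr_ae ?_
  filter_upwards [comodeL2_ae k] with x hx
  rw [hx]

theorem sqrt_two_mul_mul (a b : ℝ) : (√2 * a) * (√2 * b) = 2 * (a * b) := by
  have : √2 * √2 = 2 := Real.mul_self_sqrt (by norm_num)
  linear_combination a * b * this

theorem orthonormal_modeL2 : Orthonormal ℝ modeL2 := by
  rw [orthonormal_iff_ite]
  intro j k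
  rw [inner_modeL2]
  have : ∫ x in Ioo (0 : ℝ) 1, mode j x * modeL2 k x
      = 2 * ∫ x in (0 : ℝ)..(1 : ℕ), Real.sin (freq j * x) * Real.sin (freq k * x) := by
    rw [Nat.cast_one, intervalIntegral.integral_of_le zero_le_one, integral_Ioc_eq_integral_Ioo,
      ← integral_const_mul]
    refine integral_congr_ae ?_
    filter_upwards [modeL2_ae k] with x hx
    rw [hx, mode, mode, sqrt_two_mul_mul]
  rw [this, integral_sin_mul_sin]
  split_ifs <;> norm_num

theorem orthonormal_comodeL2 : Orthonormal ℝ comodeL2 := by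
  rw [orthonormal_iff_ite]
  intro j k
  rw [inner_comodeL2]
  have : ∫ x in Ioo (0 : ℝ) 1, comode j x * comodeL2 k x
      = 2 * ∫ x in (0 : ℝ)..(1 : ℕ), Real.cos (freq j * x) * Real.cos (freq k * x) := by
    rw [Nat.cast_one, intervalIntegral.integral_of_le zero_le_one, integral_Ioc_eq_integral_Ioo,
      ← integral_const_mul]
    refine integral_congr_ae ?_
    filter_upwards [comodeL2_ae k] with x hx
    rw [hx, comode, comode, sqrt_two_mul_mul]
  rw [this, integral_cos_mul_cos]
  split_ifs <;> norm_num

/-! ### Completeness of the eigenfunctions. -/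

/-- Multiplying sin((k+1/2)πx) by cos(πx) gives half the sum of its neighbours k ± 1, so
orthogonality survives each power. The index k runs over ℤ because the induction steps below 0. -/
theorem integral_mul_cos_pow_mul_sin_eq_zero {f : ℝ → ℝ} (hf : Integrable f muOmega)
    (h : ∀ k : ℕ, ∫ x in Ioo (0 : ℝ) 1, f x * Real.sin (freq k * x) = 0) (n : ℕ) (k : ℤ) :
    ∫ x in Ioo (0 : ℝ) 1,
      f x * (Real.cos (Real.pi * x) ^ n * Real.sin ((k + 1 / 2) * Real.pi * x)) = 0 := by
  induction n generalizing k with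
  | zero =>
    simp only [pow_zero, one_mul]
    rcases le_or_gt 0 k with hk | hk
    · lift k to ℕ using hk
      simpa [freq] using h k
    -- The index -(j+1) carries the frequency opposite to that of j, hence the same sine up to sign.
    · obtain ⟨j, rfl⟩ : ∃ j : ℕ, k = -(j + 1 : ℤ) := ⟨(-k - 1).toNat, by omega⟩
      rw [← neg_eq_zero, ← integral_neg]
      refine Eq.trans ?_ (h j)
      congr 1; ext x
      rw [← mul_neg, ← Real.sin_neg]
      congr 2
      unfold freq; push_cast; ring
  | succ n ih =>
    have hint : ∀ j : ℤ, Integrable (fun x =>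
        f x * (Real.cos (Real.pi * x) ^ n * Real.sin ((j + 1 / 2) * Real.pi * x))) muOmega := by
      intro j
      refine hf.mul_bdd (c := 1) (by fun_prop) (Filter.Eventually.of_forall fun x => ?_)
      rw [norm_mul, norm_pow]
      exact mul_le_one₀ (pow_le_one₀ (norm_nonneg _) (Real.abs_cos_le_one _)) (norm_nonneg _)
        (Real.abs_sin_le_one _)
    have e : ∀ x, f x * (Real.cos (Real.pi * x) ^ (n + 1) * Real.sin ((k + 1 / 2) * Real.pi * x))
        = (1 / 2) * (f x * (Real.cos (Real.pi * x) ^ n *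
            Real.sin (((k + 1 : ℤ) + 1 / 2) * Real.pi * x))
          + f x * (Real.cos (Real.pi * x) ^ n *
            Real.sin (((k - 1 : ℤ) + 1 / 2) * Real.pi * x))) := by
      intro x
      have e1 : (((k + 1 : ℤ) : ℝ) + 1 / 2) * Real.pi * x
          = (k + 1 / 2) * Real.pi * x + Real.pi * x := by push_cast; ring
      have e2 : (((k - 1 : ℤ) : ℝ) + 1 / 2) * Real.pi * x
          = (k + 1 / 2) * Real.pi * x - Real.pi * x := by push_cast; ring
      rw [e1, e2, Real.sin_add, Real.sin_sub]
      ring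
    simp only [e]
    rw [integral_const_mul, integral_add (hint _) (hint _), ih, ih]
    simp

/-- The product F = f sin(πx/2) is orthogonal to all polynomials in cos(πx). As x ↦ cos(πx) maps
[0,1] homeomorphically onto [-1,1], Weierstrass extends this to all continuous functions, so F = 0;
and sin(πx/2) does not vanish on (0,1). -/
theorem ae_eq_zero_of_integral_mul_sin_eq_zero {f : ℝ → ℝ} (hf : Integrable f muOmega)
    (h : ∀ k : ℕ, ∫ x in Ioo (0 : ℝ) 1, f x * Real.sin (freq k * x) = 0) :
    f =ᵐ[muOmega] 0 := by
  set F : ℝ → ℝ := fun x => f x * Real.sin (Real.pi / 2 * x) with hF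
  have hFi : Integrable F muOmega :=
    hf.mul_bdd (c := 1) (by fun_prop) (Filter.Eventually.of_forall fun x => Real.abs_sin_le_one _)
  have hpow : ∀ n : ℕ, ∫ x in Ioo (0 : ℝ) 1, F x * Real.cos (Real.pi * x) ^ n = 0 := by
    intro n
    refine Eq.trans ?_ (integral_mul_cos_pow_mul_sin_eq_zero hf h n 0)
    congr 1; ext x
    have : ((0 : ℤ) + 1 / 2 : ℝ) * Real.pi * x = Real.pi / 2 * x := by push_cast; ring
    rw [this, hF]; ring
  have hbdd : ∀ p : Polynomial ℝ,
      Integrable (fun x => F x * p.eval (Real.cos (Real.pi * x))) muOmega := by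
    intro p
    have hc : Continuous fun x => p.eval (Real.cos (Real.pi * x)) := by fun_prop
    obtain ⟨C, hC⟩ := (isCompact_Icc (a := (0 : ℝ)) (b := 1)).exists_bound_of_continuousOn
      hc.continuousOn
    refine hFi.mul_bdd (c := C) hc.aestronglyMeasurable ?_
    filter_upwards [ae_restrict_mem measurableSet_Ioo] with x hx
    exact hC x (Ioo_subset_Icc_self hx)
  have hpoly : ∀ p : Polynomial ℝ,
      ∫ x in Ioo (0 : ℝ) 1, F x * p.eval (Real.cos (Real.pi * x)) = 0 := by
    intro p
    induction p using Polynomial.induction_on' with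
    | add p q hp hq =>
      simp only [Polynomial.eval_add, mul_add]
      rw [integral_add (hbdd p) (hbdd q), hp, hq, add_zero]
    | monomial n a =>
      have : ∀ x, F x * (Polynomial.monomial n a).eval (Real.cos (Real.pi * x))
          = a * (F x * Real.cos (Real.pi * x) ^ n) := by
        intro x; rw [Polynomial.eval_monomial]; ring
      simp only [this]
      rw [integral_const_mul, hpow, mul_zero]
  have hcont : ∀ g : ℝ → ℝ, Continuous g → ∫ x in Ioo (0 : ℝ) 1, g x • F x = 0 := by
    intro g hg
    have hle : ∀ ε > 0, |∫ x in Ioo (0 : ℝ) 1, g x • F x| ≤ ε * ∫ x in Ioo (0 : ℝ) 1, |F x| := by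
      intro ε hε
      -- Substituting x = arccos(y)/π turns approximation of g by polynomials in cos(πx) into
      -- polynomial approximation in y on [-1,1].
      obtain ⟨p, hp⟩ := exists_polynomial_near_of_continuousOn (-1) 1
        (fun y => g (Real.arccos y / Real.pi))
        (hg.comp (Real.continuous_arccos.div_const _)).continuousOn ε hε
      have hp' : ∀ x ∈ Ioo (0 : ℝ) 1, |g x - p.eval (Real.cos (Real.pi * x))| ≤ ε := by
        intro x hx
        have h1 := hp (Real.cos (Real.pi * x)) ⟨Real.neg_one_le_cos _, Real.cos_le_one _⟩
        rw [Real.arccos_cos (by have := Real.pi_pos; have := hx.1; positivity)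
          (mul_le_of_le_one_right Real.pi_pos.le hx.2.le), mul_div_cancel_left₀ _ Real.pi_ne_zero]
          at h1
        rw [abs_sub_comm]
        exact h1.le
      obtain ⟨C, hC⟩ := (isCompact_Icc (a := (0 : ℝ)) (b := 1)).exists_bound_of_continuousOn
        hg.continuousOn
      have hgi : Integrable (fun x => g x • F x) muOmega := by
        refine hFi.bdd_mul (c := C) hg.aestronglyMeasurable ?_
        filter_upwards [ae_restrict_mem measurableSet_Ioo] with x hx
        exact hC x (Ioo_subset_Icc_self hx)
      have e : ∫ x in Ioo (0 : ℝ) 1, g x • F x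
          = ∫ x in Ioo (0 : ℝ) 1, (g x • F x - F x * p.eval (Real.cos (Real.pi * x))) := by
        rw [integral_sub hgi (hbdd p), hpoly, sub_zero]
      rw [e, ← integral_const_mul]
      refine (abs_integral_le_integral_abs).trans (integral_mono_ae (hgi.sub (hbdd p)).abs
        (hFi.abs.const_mul ε) ?_)
      filter_upwards [ae_restrict_mem measurableSet_Ioo] with x hx
      have : g x • F x - F x * p.eval (Real.cos (Real.pi * x))
          = (g x - p.eval (Real.cos (Real.pi * x))) * F x := by rw [smul_eq_mul]; ring
      rw [this, abs_mul]
      exact mul_le_mul_of_nonneg_right (hp' x hx) (abs_nonneg _)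
    have hlim : Filter.Tendsto (fun ε : ℝ => ε * ∫ x in Ioo (0 : ℝ) 1, |F x|)
        (nhdsWithin 0 (Ioi 0)) (nhds 0) := by
      have : Filter.Tendsto (fun ε : ℝ => ε * ∫ x in Ioo (0 : ℝ) 1, |F x|) (nhds 0)
          (nhds (0 * ∫ x in Ioo (0 : ℝ) 1, |F x|)) := Filter.tendsto_id.mul_const _
      rw [zero_mul] at this
      exact this.mono_left nhdsWithin_le_nhds
    have := ge_of_tendsto hlim (by filter_upwards [self_mem_nhdsWithin] with ε hε using hle ε hε)
    exact abs_nonpos_iff.1 this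
  have hae : ∀ᵐ x ∂muOmega, x ∈ Ioo (0 : ℝ) 1 → F x = 0 :=
    isOpen_Ioo.ae_eq_zero_of_integral_contDiff_smul_eq_zero
      (hFi.locallyIntegrable.locallyIntegrableOn _) fun g hg _ _ => hcont g hg.continuous
  filter_upwards [hae, ae_restrict_mem measurableSet_Ioo] with x h1 hx
  refine (mul_eq_zero.1 (h1 hx)).resolve_right (Real.sin_pos_of_pos_of_lt_pi ?_ ?_).ne'
  · have := Real.pi_pos; have := hx.1; positivity
  · nlinarith [Real.pi_pos, hx.2]

theorem modeL2_orthogonal_eq_bot : (Submodule.span ℝ (Set.range modeL2))ᗮ = ⊥ := by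
  rw [Submodule.eq_bot_iff]
  intro f hf
  have h := ae_eq_zero_of_integral_mul_sin_eq_zero (integrable_L2Omega f) fun k => by
    have h1 := (Submodule.mem_orthogonal _ _).1 hf (modeL2 k)
      (Submodule.subset_span (mem_range_self k))
    rw [inner_modeL2] at h1
    have h2 : √2 * ∫ x in Ioo (0 : ℝ) 1, f x * Real.sin (freq k * x) = 0 := by
      rw [← integral_const_mul]
      refine Eq.trans ?_ h1
      congr 1; ext x; unfold mode; ring
    exact (mul_eq_zero.1 h2).resolve_left (by positivity)
  exact (Lp.eq_zero_iff_ae_eq_zero).2 h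

/-- The Hilbert basis of `L²(Ω)` formed by the eigenfunctions. -/
def modeBasis : HilbertBasis ℕ ℝ L2Omega :=
  HilbertBasis.mkOfOrthogonalEqBot orthonormal_modeL2 modeL2_orthogonal_eq_bot

theorem modeBasis_apply (k : ℕ) : modeBasis k = modeL2 k := by
  rw [modeBasis, HilbertBasis.coe_mkOfOrthogonalEqBot]

/-! ### Eigenfunctions in H¹₍₀₎(Ω) and Bessel's inequality in the dual. -/

theorem mode_mem_h1ZeroGraph (k : ℕ) :
    ((modeL2 k, freq k • comodeL2 k) : L2Omega × L2Omega) ∈ h1ZeroGraph := by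
  refine ⟨?_, mode k, (continuous_mode k).continuousOn, by simp [mode], modeL2_ae k⟩
  intro ψ h1 h2 h3
  have hd : Continuous (deriv ψ) := h1.continuous_deriv (by simp)
  have hψ1 : ψ 1 = 0 := image_eq_zero_of_notMem_tsupport fun k => (lt_irrefl _ (h3 k).2)
  have hψ0 : ψ 0 = 0 := image_eq_zero_of_notMem_tsupport fun k => (lt_irrefl _ (h3 k).1)
  have e1 : ∫ x in Ioo (0 : ℝ) 1, modeL2 k x * deriv ψ x
      = ∫ x in (0 : ℝ)..1, mode k x * deriv ψ x := by
    rw [intervalIntegral.integral_of_le zero_le_one, integral_Ioc_eq_integral_Ioo]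
    refine integral_congr_ae ?_
    filter_upwards [modeL2_ae k] with x hx
    rw [hx]
  have e2 : ∫ x in Ioo (0 : ℝ) 1, (freq k • comodeL2 k : L2Omega) x * ψ x
      = ∫ x in (0 : ℝ)..1, (freq k * comode k x) * ψ x := by
    rw [intervalIntegral.integral_of_le zero_le_one, integral_Ioc_eq_integral_Ioo]
    refine integral_congr_ae ?_
    filter_upwards [comodeL2_ae k, Lp.coeFn_smul (freq k) (comodeL2 k)] with x hx hx2
    rw [hx2, Pi.smul_apply, hx, smul_eq_mul]
  simp only
  rw [e1, e2, intervalIntegral.integral_mul_deriv_eq_deriv_mul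
    (fun x _ => hasDerivAt_mode k x)
    (fun x _ => ((h1.differentiable (by simp)).differentiableAt).hasDerivAt)
    (Continuous.intervalIntegrable (by fun_prop) _ _) (hd.intervalIntegrable _ _), hψ1, hψ0]
  ring

/-- The eigenfunctions as elements of `H¹₍₀₎(Ω)`. -/
def modeH1 (k : ℕ) : H1Zero := ⟨(modeL2 k, freq k • comodeL2 k), mode_mem_h1ZeroGraph k⟩

theorem modeH1_toL2 (k : ℕ) : (modeH1 k).toL2 = modeL2 k := rfl

theorem modeH1_dx (k : ℕ) : (modeH1 k).dx = freq k • comodeL2 k := rfl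

theorem H1Zero.norm_def (z : H1Zero) : ‖z‖ = ‖z.dx‖ := rfl

/-- The eigenfunctions are weak eigenfunctions of `-∂ₓₓ`. -/
theorem inner_modeH1_dx (k : ℕ) (z : H1Zero) :
    inner ℝ (modeH1 k).dx z.dx = freq k ^ 2 * inner ℝ (modeL2 k) z.toL2 := by
  -- The boundary term at x = 1 drops because cos(ωₖ) = 0, which is the Neumann condition of the
  -- eigenfunction; at x = 0 it drops because z(0) = 0.
  rw [modeH1_dx, real_inner_smul_left, inner_comodeL2, inner_modeL2,
    z.integral_dx_mul (P := comode k) (p := fun x => freq k * mode k x) (by fun_prop)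
      (hasDerivAt_comode k) (by simp [comode, cos_freq])]
  simp only [mul_assoc]
  rw [integral_const_mul]
  ring

/-- Bessel's inequality in `H⁻¹₍₀₎(Ω)`. -/
theorem sum_sq_div_freq_le (φ₁ : HNegOne) (s : Finset ℕ) :
    ∑ k ∈ s, (φ₁ (modeH1 k) / freq k) ^ 2 ≤ ‖φ₁‖ ^ 2 := by
  set X := ∑ k ∈ s, (φ₁ (modeH1 k) / freq k) ^ 2 with hX
  have hX0 : 0 ≤ X := Finset.sum_nonneg fun _ _ => sq_nonneg _
  -- This is the truncated Riesz representative of φ₁: it satisfies φ₁(y) = ‖y‖² = X, so the dual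
  -- norm bounds √X.
  set y : H1Zero := ∑ k ∈ s, (φ₁ (modeH1 k) / freq k ^ 2) • modeH1 k with hy
  have h1 : φ₁ y = X := by
    rw [hy, map_sum, hX]
    refine Finset.sum_congr rfl fun k _ => ?_
    rw [map_smul, smul_eq_mul, div_pow]
    ring
  have h2 : y.dx = ∑ k ∈ s, (φ₁ (modeH1 k) / freq k) • comodeL2 k := by
    rw [hy, map_sum]
    refine Finset.sum_congr rfl fun k _ => ?_
    rw [map_smul, modeH1_dx, smul_smul]
    congr 1
    have := freq_ne_zero k
    field_simp
  have h3 : ‖y‖ ^ 2 = X := by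
    rw [H1Zero.norm_def, h2, ← real_inner_self_eq_norm_sq, orthonormal_comodeL2.inner_sum, hX]
    refine Finset.sum_congr rfl fun k _ => ?_
    simp [sq]
  have h4 : X ≤ ‖φ₁‖ * ‖y‖ := by
    rw [← h1]
    exact (le_abs_self _).trans (φ₁.le_opNorm y)
  rw [← h3] at h4 ⊢
  rcases (norm_nonneg y).eq_or_lt with h0 | h0
  · rw [← h0, zero_pow two_ne_zero]; positivity
  · have : ‖y‖ ≤ ‖φ₁‖ := by
      rw [sq] at h4
      exact le_of_mul_le_mul_right h4 h0
    gcongr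

/-! ### Slices of the cylinder and the coefficients of a function on it. -/

/-- Lebesgue measure on `(0,T)`. -/
abbrev muTime (T : ℝ) : Measure ℝ := volume.restrict (Ioo (0 : ℝ) T)

theorem restrict_cyl (T : ℝ) : volume.restrict (cyl T) = muOmega.prod (muTime T) := by
  rw [Measure.prod_restrict, Measure.volume_eq_prod]

theorem measurePreserving_swap_cyl (T : ℝ) :
    MeasurePreserving Prod.swap ((muTime T).prod muOmega) (volume.restrict (cyl T)) := by
  rw [restrict_cyl]
  exact Measure.measurePreserving_swap

theorem ae_ae_of_ae_cyl {T : ℝ} {P : ℝ × ℝ → Prop} (h : ∀ᵐ p ∂volume.restrict (cyl T), P p) :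
    ∀ᵐ t ∂muTime T, ∀ᵐ x ∂muOmega, P (x, t) :=
  Measure.ae_ae_of_ae_prod ((measurePreserving_swap_cyl T).quasiMeasurePreserving.ae h)

theorem integrable_swap_cyl {T : ℝ} {f : ℝ × ℝ → ℝ} (hf : Integrable f (volume.restrict (cyl T))) :
    Integrable (fun p : ℝ × ℝ => f (p.2, p.1)) ((muTime T).prod muOmega) := by
  rw [restrict_cyl] at hf
  exact hf.swap

theorem integral_cyl {T : ℝ} {f : ℝ × ℝ → ℝ} (hf : Integrable f (volume.restrict (cyl T))) :
    ∫ p in cyl T, f p = ∫ t in Ioo 0 T, ∫ x in Ioo (0 : ℝ) 1, f (x, t) := by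
  rw [restrict_cyl] at hf ⊢
  exact integral_prod_symm f hf

theorem aestronglyMeasurable_section {T : ℝ} {f : ℝ × ℝ → ℝ}
    (hf : AEStronglyMeasurable f (volume.restrict (cyl T))) :
    ∀ᵐ t ∂muTime T, AEStronglyMeasurable (fun x => f (x, t)) muOmega := by
  have := hf.comp_measurePreserving (measurePreserving_swap_cyl T)
  exact this.prodMk_left

theorem memLp_section {T : ℝ} {f : ℝ × ℝ → ℝ} (hf : MemLp f 2 (volume.restrict (cyl T))) :
    ∀ᵐ t ∂muTime T, MemLp (fun x => f (x, t)) 2 muOmega := by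
  filter_upwards [aestronglyMeasurable_section hf.aestronglyMeasurable,
    (integrable_swap_cyl hf.integrable_sq).prod_right_ae] with t h1 h2
  exact (memLp_two_iff_integrable_sq h1).2 h2

/-- The coefficient of `f(·,t)` along the `k`-th eigenfunction. -/
def coeff (f : ℝ × ℝ → ℝ) (k : ℕ) (t : ℝ) : ℝ := ∫ x in Ioo (0 : ℝ) 1, mode k x * f (x, t)

theorem coeff_eq_inner {f : ℝ × ℝ → ℝ} {t : ℝ} (hf : MemLp (fun x => f (x, t)) 2 muOmega) (k : ℕ) :
    coeff f k t = inner ℝ (modeL2 k) hf.toLp := by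
  rw [inner_modeL2, coeff]
  refine integral_congr_ae ?_
  filter_upwards [hf.coeFn_toLp] with x hx
  rw [hx]

theorem norm_sq_Lp_two {α : Type*} [MeasurableSpace α] {μ : Measure α} (u : Lp ℝ 2 μ) :
    ‖u‖ ^ 2 = ∫ x, u x ^ 2 ∂μ := by
  rw [← real_inner_self_eq_norm_sq, L2.inner_def]
  refine integral_congr_ae (Filter.Eventually.of_forall fun x => ?_)
  simp [sq]

theorem norm_sq_toLp {α : Type*} [MeasurableSpace α] {μ : Measure α} {f : α → ℝ}
    (hf : MemLp f 2 μ) : ‖hf.toLp‖ ^ 2 = ∫ x, f x ^ 2 ∂μ := by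
  rw [norm_sq_Lp_two]
  refine integral_congr_ae ?_
  filter_upwards [hf.coeFn_toLp] with x hx
  rw [hx]

theorem sum_coeff_sq_le {f : ℝ × ℝ → ℝ} {t : ℝ} (hf : MemLp (fun x => f (x, t)) 2 muOmega)
    (s : Finset ℕ) : ∑ k ∈ s, coeff f k t ^ 2 ≤ ∫ x in Ioo (0 : ℝ) 1, f (x, t) ^ 2 := by
  have := orthonormal_modeL2.sum_inner_products_le (x := hf.toLp) (s := s)
  rw [norm_sq_toLp] at this
  refine le_trans (le_of_eq ?_) this
  refine Finset.sum_congr rfl fun k _ => ?_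
  rw [coeff_eq_inner hf, Real.norm_eq_abs, sq_abs]

theorem hasSum_coeff_sq {f : ℝ × ℝ → ℝ} {t : ℝ} (hf : MemLp (fun x => f (x, t)) 2 muOmega) :
    HasSum (fun k => coeff f k t ^ 2) (∫ x in Ioo (0 : ℝ) 1, f (x, t) ^ 2) := by
  have := modeBasis.hasSum_inner_mul_inner hf.toLp hf.toLp
  rw [real_inner_self_eq_norm_sq, norm_sq_toLp] at this
  refine this.congr_fun fun k => ?_
  rw [coeff_eq_inner hf, modeBasis_apply, real_inner_comm, sq]

theorem integrable_mode_mul {T : ℝ} {f : ℝ × ℝ → ℝ} (hf : Integrable f (volume.restrict (cyl T)))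
    (k : ℕ) : Integrable (fun p => mode k p.1 * f p) (volume.restrict (cyl T)) :=
  hf.bdd_mul (c := √2) (by fun_prop) (Filter.Eventually.of_forall fun p => abs_mode_le k p.1)

instance (T : ℝ) : IsFiniteMeasure (volume.restrict (cyl T)) := by
  rw [restrict_cyl]; infer_instance

theorem memLp_coeff {T : ℝ} {f : ℝ × ℝ → ℝ} (hf : MemLp f 2 (volume.restrict (cyl T))) (k : ℕ) :
    MemLp (coeff f k) 2 (muTime T) := by
  have hf1 : Integrable f (volume.restrict (cyl T)) := hf.integrable (by norm_num)
  have h1 : AEStronglyMeasurable (coeff f k) (muTime T) :=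
    (integrable_swap_cyl (integrable_mode_mul hf1 k)).integral_prod_left.aestronglyMeasurable
  rw [memLp_two_iff_integrable_sq h1]
  refine (integrable_swap_cyl hf.integrable_sq).integral_prod_left.mono' (h1.pow 2) ?_
  filter_upwards [memLp_section hf] with t ht
  rw [Real.norm_eq_abs, abs_of_nonneg (sq_nonneg _)]
  simpa using sum_coeff_sq_le ht {k}

theorem exists_bound_of_continuous_time {T : ℝ} {q : ℝ → ℝ} (hq : Continuous q) :
    ∃ C, ∀ᵐ p ∂volume.restrict (cyl T), ‖q p.2‖ ≤ C := by
  obtain ⟨C, hC⟩ := (isCompact_Icc (a := (0 : ℝ)) (b := T)).exists_bound_of_continuousOn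
    hq.continuousOn
  refine ⟨C, ?_⟩
  filter_upwards [ae_restrict_mem (measurableSet_Ioo.prod measurableSet_Ioo)] with p hp
  exact hC p.2 (Ioo_subset_Icc_self hp.2)

theorem integral_cyl_mul_mode {T : ℝ} {f : ℝ × ℝ → ℝ} (hf : MemLp f 2 (volume.restrict (cyl T)))
    {q : ℝ → ℝ} (hq : Continuous q) (k : ℕ) :
    Integrable (fun p => q p.2 * (mode k p.1 * f p)) (volume.restrict (cyl T)) ∧
    ∫ p in cyl T, q p.2 * (mode k p.1 * f p) = ∫ t in Ioo 0 T, q t * coeff f k t := by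
  have hf1 : Integrable f (volume.restrict (cyl T)) := hf.integrable (by norm_num)
  obtain ⟨C, hC⟩ := exists_bound_of_continuous_time (T := T) hq
  have hi : Integrable (fun p => q p.2 * (mode k p.1 * f p)) (volume.restrict (cyl T)) :=
    (integrable_mode_mul hf1 k).bdd_mul (c := C) (by fun_prop) hC
  refine ⟨hi, ?_⟩
  rw [integral_cyl hi]
  congr 1; ext t
  simp only [coeff]
  rw [integral_const_mul]

theorem LinfCyl.ae_abs_le {T : ℝ} (A : LinfCyl T) :
    ∀ᵐ p ∂volume.restrict (cyl T), |A p| ≤ ‖A‖ := by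
  have h := ae_le_eLpNormEssSup (f := A) (μ := volume.restrict (cyl T))
  have hfin : eLpNormEssSup A (volume.restrict (cyl T)) ≠ ⊤ := by
    have := (Lp.memLp A).2.ne
    rwa [eLpNorm_exponent_top] at this
  filter_upwards [h] with p hp
  rw [Lp.norm_def, eLpNorm_exponent_top, ← Real.norm_eq_abs, ← toReal_enorm]
  exact ENNReal.toReal_mono hfin hp

/-! ### Separated backward solutions and variation of constants. -/

/-- The functional `z ↦ ∫ eₖ z` on `H¹₍₀₎(Ω)`. -/
def modeDual (k : ℕ) : HNegOne :=
  LinearMap.mkContinuous ((innerSL ℝ (modeL2 k)).toLinearMap.comp H1Zero.toL2) (freq k)⁻¹ fun z => by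
    -- By the weak eigenvalue equation ωₖ² |(eₖ,z)| = |(∂ₓeₖ,∂ₓz)| ≤ ωₖ ‖∂ₓz‖, hence the norm bound
    -- 1/ωₖ.
    have h1 := abs_real_inner_le_norm (modeH1 k).dx z.dx
    rw [inner_modeH1_dx, modeH1_dx, norm_smul, orthonormal_comodeL2.1, abs_mul, mul_one,
      Real.norm_eq_abs, abs_of_pos (freq_pos k), abs_of_pos (pow_pos (freq_pos k) 2)] at h1
    simp only [LinearMap.coe_comp, Function.comp, ContinuousLinearMap.coe_coe, innerSL_apply_apply,
      Real.norm_eq_abs]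
    rw [H1Zero.norm_def, inv_mul_eq_div, le_div_iff₀ (freq_pos k)]
    refine le_of_mul_le_mul_left ?_ (freq_pos k)
    calc _ = freq k ^ 2 * |inner ℝ (modeL2 k) z.toL2| := by ring
      _ ≤ _ := h1

theorem modeDual_apply (k : ℕ) (z : H1Zero) : modeDual k z = inner ℝ (modeL2 k) z.toL2 := rfl

/-- The source of the backward problem solved by `θ(t) eₖ(x)`. -/
theorem memLp_source {T : ℝ} (A : LinfCyl T) {q θ : ℝ → ℝ} (hq : Continuous q) (hθ : Continuous θ)
    (k : ℕ) : MemLp (fun p : ℝ × ℝ => q p.2 * mode k p.1 + A p * (θ p.2 * mode k p.1)) 2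
      (volume.restrict (cyl T)) := by
  have h1 : ∀ r : ℝ → ℝ, Continuous r →
      MemLp (fun p : ℝ × ℝ => r p.2 * mode k p.1) 2 (volume.restrict (cyl T)) := by
    intro r hr
    obtain ⟨C, hC⟩ := exists_bound_of_continuous_time (T := T) hr
    refine MemLp.of_bound (by fun_prop) (C * √2) ?_
    filter_upwards [hC] with p hp
    rw [norm_mul]
    exact mul_le_mul hp (abs_mode_le k p.1) (norm_nonneg _) ((norm_nonneg _).trans hp)
  refine (h1 q hq).add ?_
  exact (h1 θ hθ).mul' (Lp.memLp A)

/-- `θ(t) eₖ(x)` solves the backward problem with source `(θ'' + ωₖ² θ) eₖ + A θ eₖ`. -/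
theorem isBackwardWeakSolution_mode {T : ℝ} (A : LinfCyl T) {q θ θ' : ℝ → ℝ} (k : ℕ)
    (hq : Continuous q) (hθ : ∀ t, HasDerivAt θ (θ' t) t)
    (hθ' : ∀ t, HasDerivAt θ' (q t - freq k ^ 2 * θ t) t) (hθT : θ T = 0) (hθ'T : θ' T = 0)
    (hθc : Continuous θ) :
    IsBackwardWeakSolution T A (memLp_source A hq hθc k).toLp
      (fun t => θ t • modeH1 k) (fun t => θ' t • modeL2 k) where
  continuousOn := (hθc.smul continuous_const).continuousOn
  hasDeriv t _ := by
    simp only [map_smul, modeH1_toL2]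
    exact ((hθ t).smul_const _).hasDerivWithinAt
  continuousOn_deriv := by
    have : Continuous θ' := continuous_iff_continuousAt.2 fun t => (hθ' t).continuousAt
    exact (this.smul continuous_const).continuousOn
  equation := by
    have hc : Continuous fun t => q t - freq k ^ 2 * θ t := by fun_prop
    -- The coefficient is θ''. The term -ωₖ²θ cancels the stiffness term, and the potential term
    -- cancels against the matching part of the source.
    refine ⟨fun t => (q t - freq k ^ 2 * θ t) • modeDual k,
      memLp_of_continuousOn (hc.smul continuous_const).continuousOn, ?_, ?_⟩
    · intro t _ z
      rw [← inner_L2Omega, ← inner_L2Omega, intervalIntegral.integral_smul_const,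
        intervalIntegral.integral_eq_sub_of_hasDerivAt (fun s _ => hθ' s)
          (hc.intervalIntegrable _ _), real_inner_smul_left, real_inner_smul_left]
      simp only [smul_apply, smul_eq_mul, modeDual_apply]
      ring
    · filter_upwards [ae_ae_of_ae_cyl (memLp_source A hq hθc k).coeFn_toLp,
        ae_ae_of_ae_cyl A.ae_abs_le, aestronglyMeasurable_section
          (Lp.memLp A).aestronglyMeasurable] with t h1 h2 h3 z
      have i1 : Integrable (fun x => mode k x * z.toL2 x) muOmega :=
        (integrable_L2Omega z.toL2).bdd_mul (c := √2) (by fun_prop)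
          (Filter.Eventually.of_forall fun x => abs_mode_le k x)
      have i2 : Integrable (fun x => A (x, t) * (mode k x * z.toL2 x)) muOmega :=
        i1.bdd_mul (c := ‖A‖) h3 h2
      have e1 : ∫ x in Ioo (0 : ℝ) 1, (memLp_source A hq hθc k).toLp _ (x, t) * z.toL2 x
          = q t * (∫ x in Ioo (0 : ℝ) 1, mode k x * z.toL2 x)
            + θ t * ∫ x in Ioo (0 : ℝ) 1, A (x, t) * (mode k x * z.toL2 x) := by
        rw [← integral_const_mul, ← integral_const_mul, ← integral_add (i1.const_mul _)
          (i2.const_mul _)]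
        refine integral_congr_ae ?_
        filter_upwards [h1] with x hx
        rw [hx]; ring
      have e2 : ∫ x in Ioo (0 : ℝ) 1, A (x, t) * (θ t • modeH1 k).toL2 x * z.toL2 x
          = θ t * ∫ x in Ioo (0 : ℝ) 1, A (x, t) * (mode k x * z.toL2 x) := by
        rw [← integral_const_mul]
        refine integral_congr_ae ?_
        rw [map_smul, modeH1_toL2]
        filter_upwards [modeL2_ae k, Lp.coeFn_smul (θ t) (modeL2 k)] with x hx hx2
        rw [hx2, Pi.smul_apply, hx, smul_eq_mul]; ring
      rw [e1, e2, ← inner_L2Omega, map_smul, real_inner_smul_left, inner_modeH1_dx,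
        smul_apply, modeDual_apply, inner_modeL2, smul_eq_mul]
      ring
  final := by simp [hθT]
  final_deriv := by simp [hθ'T]

/-- Solution of `θ'' + ωₖ² θ = q` with zero data at time `T`. -/
def backwardDuhamel (k : ℕ) (T : ℝ) (q : ℝ → ℝ) (t : ℝ) : ℝ :=
  ∫ s in t..T, q s * (Real.sin (freq k * (s - t)) / freq k)

/-- The time derivative of `backwardDuhamel`. -/
def backwardDuhamelDeriv (k : ℕ) (T : ℝ) (q : ℝ → ℝ) (t : ℝ) : ℝ :=
  -∫ s in t..T, q s * Real.cos (freq k * (s - t))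

/-- The addition formula takes t out of the integrand, so the derivative in t needs only the product
rule and the fundamental theorem of calculus. -/
theorem backwardDuhamel_eq (k : ℕ) (T : ℝ) {q : ℝ → ℝ} (hq : Continuous q) (t : ℝ) :
    backwardDuhamel k T q t = (Real.cos (freq k * t) * (∫ s in t..T, q s * Real.sin (freq k * s))
      - Real.sin (freq k * t) * (∫ s in t..T, q s * Real.cos (freq k * s))) / freq k := by
  rw [← intervalIntegral.integral_const_mul, ← intervalIntegral.integral_const_mul,
    ← intervalIntegral.integral_sub (Continuous.intervalIntegrable (by fun_prop) _ _)
      (Continuous.intervalIntegrable (by fun_prop) _ _), ← intervalIntegral.integral_div]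
  refine intervalIntegral.integral_congr fun s _ => ?_
  rw [mul_sub, Real.sin_sub]
  ring

theorem backwardDuhamelDeriv_eq (k : ℕ) (T : ℝ) {q : ℝ → ℝ} (hq : Continuous q) (t : ℝ) :
    backwardDuhamelDeriv k T q t
      = -(Real.sin (freq k * t) * (∫ s in t..T, q s * Real.sin (freq k * s))
        + Real.cos (freq k * t) * (∫ s in t..T, q s * Real.cos (freq k * s))) := by
  rw [← intervalIntegral.integral_const_mul, ← intervalIntegral.integral_const_mul,
    ← intervalIntegral.integral_add (Continuous.intervalIntegrable (by fun_prop) _ _)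
      (Continuous.intervalIntegrable (by fun_prop) _ _), backwardDuhamelDeriv]
  congr 1
  refine intervalIntegral.integral_congr fun s _ => ?_
  rw [mul_sub, Real.cos_sub]
  ring

theorem hasDerivAt_integral_left {f : ℝ → ℝ} (hf : Continuous f) (T t : ℝ) :
    HasDerivAt (fun t => ∫ s in t..T, f s) (-f t) t :=
  intervalIntegral.integral_hasDerivAt_left (hf.intervalIntegrable _ _)
    (hf.stronglyMeasurableAtFilter _ _) hf.continuousAt

theorem hasDerivAt_sin_freq (k : ℕ) (t : ℝ) :
    HasDerivAt (fun t => Real.sin (freq k * t)) (Real.cos (freq k * t) * freq k) t := by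
  simpa using ((hasDerivAt_id t).const_mul (freq k)).sin

theorem hasDerivAt_cos_freq (k : ℕ) (t : ℝ) :
    HasDerivAt (fun t => Real.cos (freq k * t)) (-Real.sin (freq k * t) * freq k) t := by
  simpa using ((hasDerivAt_id t).const_mul (freq k)).cos

theorem hasDerivAt_backwardDuhamel (k : ℕ) (T : ℝ) {q : ℝ → ℝ} (hq : Continuous q) (t : ℝ) :
    HasDerivAt (backwardDuhamel k T q) (backwardDuhamelDeriv k T q t) t := by
  rw [funext (backwardDuhamel_eq k T hq), backwardDuhamelDeriv_eq k T hq]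
  have h1 := hasDerivAt_integral_left (f := fun s => q s * Real.sin (freq k * s)) (by fun_prop) T t
  have h2 := hasDerivAt_integral_left (f := fun s => q s * Real.cos (freq k * s)) (by fun_prop) T t
  refine ((((hasDerivAt_cos_freq k t).mul h1).sub ((hasDerivAt_sin_freq k t).mul h2)).div_const
    (freq k)).congr_deriv ?_
  have := freq_ne_zero k
  field_simp
  ring

theorem hasDerivAt_backwardDuhamelDeriv (k : ℕ) (T : ℝ) {q : ℝ → ℝ} (hq : Continuous q) (t : ℝ) :
    HasDerivAt (backwardDuhamelDeriv k T q) (q t - freq k ^ 2 * backwardDuhamel k T q t) t := by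
  rw [funext (backwardDuhamelDeriv_eq k T hq), backwardDuhamel_eq k T hq]
  have h1 := hasDerivAt_integral_left (f := fun s => q s * Real.sin (freq k * s)) (by fun_prop) T t
  have h2 := hasDerivAt_integral_left (f := fun s => q s * Real.cos (freq k * s)) (by fun_prop) T t
  refine ((((hasDerivAt_sin_freq k t).mul h1).add ((hasDerivAt_cos_freq k t).mul h2)).neg).congr_deriv
    ?_
  have := freq_ne_zero k
  have hsc := Real.sin_sq_add_cos_sq (freq k * t)
  field_simp
  linear_combination (q t) * hsc

/-- The Duhamel operator `v ↦ ∫₀ᵗ sin(ωₖ(t-s))/ωₖ v(s) ds`. -/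
def duhamel (k : ℕ) (v : ℝ → ℝ) (t : ℝ) : ℝ :=
  ∫ s in (0 : ℝ)..t, Real.sin (freq k * (t - s)) / freq k * v s

/-- The forward and backward Duhamel operators have the same kernel on the triangle s < t and are
therefore adjoint to each other. This transfers the potential term from the test function to the
coefficient of Aφ. -/
theorem integral_mul_duhamel {T : ℝ} {v : ℝ → ℝ} (hv : IntegrableOn v (Ioo 0 T)) {q : ℝ → ℝ}
    (hq : Continuous q) (k : ℕ) :
    ∫ t in Ioo 0 T, q t * duhamel k v t = ∫ t in Ioo 0 T, backwardDuhamel k T q t * v t := by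
  have := (integral_triangle_swap hv
    (c := fun t s => q t * (Real.sin (freq k * (t - s)) / freq k)) (by fun_prop)).2
  simp only [backwardDuhamel]
  rw [← this]
  congr 1; ext t
  rw [duhamel, ← intervalIntegral.integral_const_mul]
  congr 1; ext s
  ring

/-- After the addition formula, only primitives of integrable functions times sines and cosines
remain; no continuity of v is required. -/
theorem continuousOn_duhamel {T : ℝ} (hT : 0 ≤ T) {v : ℝ → ℝ} (hv : IntegrableOn v (Ioo 0 T))
    (k : ℕ) : ContinuousOn (duhamel k v) (Icc 0 T) := by
  have hb : ∀ c : ℝ → ℝ, Continuous c → (∀ s, |c s| ≤ 1) →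
      IntegrableOn (fun s => c s * v s) (Ioo 0 T) := fun c hc hc1 =>
    Integrable.bdd_mul (c := 1) hv hc.aestronglyMeasurable (Filter.Eventually.of_forall hc1)
  have h1 := hb (fun s => Real.cos (freq k * s)) (by fun_prop) fun s => Real.abs_cos_le_one _
  have h2 := hb (fun s => Real.sin (freq k * s)) (by fun_prop) fun s => Real.abs_sin_le_one _
  have hC := continuousOn_primitive_of_Ioo hT h1
  have hS := continuousOn_primitive_of_Ioo hT h2
  have hsin : ContinuousOn (fun t => Real.sin (freq k * t)) (Icc 0 T) := by fun_prop
  have hcos : ContinuousOn (fun t => Real.cos (freq k * t)) (Icc 0 T) := by fun_prop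
  refine (((hsin.mul hC).sub (hcos.mul hS)).div_const (freq k)).congr fun t ht => ?_
  have h0 : (0 : ℝ) ∈ Icc 0 T := left_mem_Icc.2 hT
  simp only [Pi.sub_apply, Pi.mul_apply]
  rw [← intervalIntegral.integral_const_mul, ← intervalIntegral.integral_const_mul,
    ← intervalIntegral.integral_sub ((intervalIntegrable_of_Ioo h1 h0 ht).const_mul _)
      ((intervalIntegrable_of_Ioo h2 h0 ht).const_mul _), ← intervalIntegral.integral_div]
  refine intervalIntegral.integral_congr fun s _ => ?_
  rw [mul_sub, Real.sin_sub]
  ring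

/-- The `k`-th coefficient of the free wave with data `(φ₀, φ₁)`. -/
def freeCoeff (φ₀ : L2Omega) (φ₁ : HNegOne) (k : ℕ) (t : ℝ) : ℝ :=
  inner ℝ (modeL2 k) φ₀ * Real.cos (freq k * t)
    + φ₁ (modeH1 k) / freq k * Real.sin (freq k * t)

theorem memLp_potential_mul {T : ℝ} (A : LinfCyl T) (φ : L2Cyl T) :
    MemLp (fun p => A p * φ p) 2 (volume.restrict (cyl T)) :=
  (Lp.memLp φ).mul' (Lp.memLp A)

theorem integral_zero_source {T : ℝ} (w : ℝ → ℝ → ℝ) :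
    ∫ t in Ioo (0 : ℝ) T, ∫ x in Ioo (0 : ℝ) 1, (0 : L2Cyl T) (x, t) * w t x = 0 := by
  refine integral_eq_zero_of_ae ?_
  filter_upwards [ae_ae_of_ae_cyl (Lp.coeFn_zero ℝ 2 (volume.restrict (cyl T)))] with t ht
  refine integral_eq_zero_of_ae ?_
  filter_upwards [ht] with x hx
  rw [hx, Pi.zero_apply, zero_mul, Pi.zero_apply]

/-- Variation of constants for the coefficients of a transposition solution. -/
theorem coeff_ae_eq {T : ℝ} (hT : 0 < T) {A : LinfCyl T} {φ₀ : L2Omega} {φ₁ : HNegOne}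
    {φ : L2Cyl T} (h : IsTranspositionSolution T A 0 φ₀ φ₁ φ) (k : ℕ) :
    coeff φ k =ᵐ[muTime T] fun t =>
      freeCoeff φ₀ φ₁ k t - duhamel k (coeff (fun p => A p * φ p) k) t := by
  set hφ : ℝ × ℝ → ℝ := fun p => A p * φ p with hh
  have hφm : MemLp hφ 2 (volume.restrict (cyl T)) := memLp_potential_mul A φ
  have hv : IntegrableOn (coeff hφ k) (Ioo 0 T) := (memLp_coeff hφm k).integrable (by norm_num)
  have hu : IntegrableOn (coeff φ k) (Ioo 0 T) :=
    (memLp_coeff (Lp.memLp φ) k).integrable (by norm_num)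
  have hd : IntegrableOn (duhamel k (coeff hφ k)) (Ioo 0 T) :=
    (memLp_of_continuousOn (p := 1) (continuousOn_duhamel hT.le hv k)).integrable le_rfl
  have hfc : Continuous (freeCoeff φ₀ φ₁ k) := by unfold freeCoeff; fun_prop
  have hf : IntegrableOn (freeCoeff φ₀ φ₁ k) (Ioo 0 T) :=
    (memLp_of_continuousOn (p := 1) hfc.continuousOn).integrable le_rfl
  have key : ∀ q : ℝ → ℝ, Continuous q → ∫ t in Ioo 0 T,
      q t • (coeff φ k t + duhamel k (coeff hφ k) t - freeCoeff φ₀ φ₁ k t) = 0 := by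
    intro q hq
    have hθ := hasDerivAt_backwardDuhamel k T hq
    have hθ' := hasDerivAt_backwardDuhamelDeriv k T hq
    have hθc : Continuous (backwardDuhamel k T q) :=
      continuous_iff_continuousAt.2 fun t => (hθ t).continuousAt
    have hw := isBackwardWeakSolution_mode A k hq hθ hθ' (by simp [backwardDuhamel])
      (by simp [backwardDuhamelDeriv]) hθc
    -- The arbitrary q is the part of the source that tests the coefficient of φ. The remaining
    -- part, Aθeₖ, pairs with φ as θ with the coefficient of Aφ.
    have e := h _ _ _ hw
    obtain ⟨i1, e1⟩ := integral_cyl_mul_mode (Lp.memLp φ) hq k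
    obtain ⟨i2, e2⟩ := integral_cyl_mul_mode hφm hθc k
    have el : ∫ p in cyl T, φ p * (memLp_source A hq hθc k).toLp _ p
        = (∫ t in Ioo 0 T, q t * coeff φ k t)
          + ∫ t in Ioo 0 T, q t * duhamel k (coeff hφ k) t := by
      rw [integral_mul_duhamel hv hq, ← e1, ← e2, ← integral_add i1 i2]
      refine integral_congr_ae ?_
      filter_upwards [(memLp_source A hq hθc k).coeFn_toLp] with p hp
      rw [hp, hh]; ring
    -- At time 0 the backward solution has position ∫ q sin(ωₖs)/ωₖ and velocity -∫ q cos(ωₖs), so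
    -- pairing with the data gives ∫ q times the free oscillation.
    have er : φ₁ (backwardDuhamel k T q 0 • modeH1 k)
          - ∫ x in Ioo (0 : ℝ) 1, φ₀ x * (backwardDuhamelDeriv k T q 0 • modeL2 k : L2Omega) x
        = ∫ t in Ioo 0 T, q t * freeCoeff φ₀ φ₁ k t := by
      rw [← inner_L2Omega, real_inner_smul_right, map_smul, smul_eq_mul, real_inner_comm,
        ← integral_Ioc_eq_integral_Ioo, ← intervalIntegral.integral_of_le hT.le, backwardDuhamel,
        backwardDuhamelDeriv, neg_mul, sub_neg_eq_add, ← intervalIntegral.integral_mul_const,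
        ← intervalIntegral.integral_mul_const, ← intervalIntegral.integral_add
          (Continuous.intervalIntegrable (by fun_prop) _ _)
          (Continuous.intervalIntegrable (by fun_prop) _ _)]
      refine intervalIntegral.integral_congr fun t _ => ?_
      simp only [freeCoeff, sub_zero]
      ring
    rw [el, integral_zero_source (fun t x => (backwardDuhamel k T q t • modeH1 k).toL2 x),
      zero_add, er] at e
    have hb : ∀ v : ℝ → ℝ, IntegrableOn v (Ioo 0 T) → IntegrableOn (fun t => q t * v t) (Ioo 0 T) := by
      intro v hv
      obtain ⟨C, hC⟩ := (isCompact_Icc (a := (0 : ℝ)) (b := T)).exists_bound_of_continuousOn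
        hq.continuousOn
      refine Integrable.bdd_mul (c := C) hv hq.aestronglyMeasurable ?_
      filter_upwards [ae_restrict_mem measurableSet_Ioo] with t ht
      exact hC t (Ioo_subset_Icc_self ht)
    simp only [smul_eq_mul, mul_sub, mul_add]
    have hs := integral_sub ((hb _ hu).add (hb _ hd)) (hb _ hf)
    simp only [Pi.add_apply] at hs
    rw [hs, integral_add (hb _ hu) (hb _ hd), e, sub_self]
  have hae : ∀ᵐ t ∂muTime T, t ∈ Ioo (0 : ℝ) T →
      coeff φ k t + duhamel k (coeff hφ k) t - freeCoeff φ₀ φ₁ k t = 0 :=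
    isOpen_Ioo.ae_eq_zero_of_integral_contDiff_smul_eq_zero
      (((hu.add hd).sub hf).locallyIntegrable.locallyIntegrableOn _)
      fun g hg _ _ => key g hg.continuous
  filter_upwards [hae, ae_restrict_mem measurableSet_Ioo] with t h1 h2
  have := h1 h2
  linarith

/-! ### Weighted energy estimate. -/

/-- Cauchy-Schwarz for a weighted integral. -/
theorem sq_integral_mul_le {t K : ℝ} (ht : 0 ≤ t) {κ V : ℝ → ℝ} (hκ : Continuous κ)
    (hκ0 : ∀ s ∈ Icc 0 t, 0 ≤ κ s) (hK : ∫ s in (0 : ℝ)..t, κ s ≤ K) (hK0 : 0 < K)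
    (hV : IntervalIntegrable V volume 0 t)
    (hV2 : IntervalIntegrable (fun s => V s ^ 2) volume 0 t) :
    (∫ s in (0 : ℝ)..t, κ s * V s) ^ 2 ≤ K * ∫ s in (0 : ℝ)..t, κ s * V s ^ 2 := by
  set M := ∫ s in (0 : ℝ)..t, κ s * V s with hM
  have i1 : IntervalIntegrable (fun s => κ s * V s) volume 0 t := hV.continuousOn_mul hκ.continuousOn
  have i2 : IntervalIntegrable (fun s => κ s * V s ^ 2) volume 0 t :=
    hV2.continuousOn_mul hκ.continuousOn
  -- Expanding the weighted square of V - M/K gives the claim directly. Only an upper bound K for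
  -- the mass of κ is needed.
  have h0 : 0 ≤ ∫ s in (0 : ℝ)..t, κ s * (V s - M / K) ^ 2 :=
    intervalIntegral.integral_nonneg ht fun s hs => mul_nonneg (hκ0 s hs) (sq_nonneg _)
  have e : ∫ s in (0 : ℝ)..t, κ s * (V s - M / K) ^ 2
      = (∫ s in (0 : ℝ)..t, κ s * V s ^ 2) - 2 * (M / K) * M
        + (M / K) ^ 2 * ∫ s in (0 : ℝ)..t, κ s := by
    rw [hM, ← intervalIntegral.integral_const_mul, ← intervalIntegral.integral_const_mul,
      ← intervalIntegral.integral_sub i2 (i1.const_mul _), ← intervalIntegral.integral_add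
        (i2.sub (i1.const_mul _)) ((hκ.intervalIntegrable _ _).const_mul _)]
    refine intervalIntegral.integral_congr fun s _ => ?_
    ring
  have h1 : (M / K) ^ 2 * ∫ s in (0 : ℝ)..t, κ s ≤ (M / K) ^ 2 * K :=
    mul_le_mul_of_nonneg_left hK (sq_nonneg _)
  have h2 : (M / K) ^ 2 * K = M ^ 2 / K := by field_simp
  have h3 : 2 * (M / K) * M = 2 * (M ^ 2 / K) := by ring
  have h4 : M ^ 2 / K ≤ ∫ s in (0 : ℝ)..t, κ s * V s ^ 2 := by linarith
  rwa [div_le_iff₀ hK0, mul_comm] at h4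

/-- The right side is the value of the integral over the whole half-line. It bounds the mass of the
exponentially damped kernel r, uniformly in the length. -/
theorem integral_mul_exp_neg_le {l r : ℝ} (hl : 0 < l) (hr : 0 ≤ r) :
    ∫ s in (0 : ℝ)..r, s * Real.exp (-(l * s)) ≤ 1 / l ^ 2 := by
  have hd : ∀ s : ℝ, HasDerivAt (fun s => -((s / l + 1 / l ^ 2) * Real.exp (-(l * s))))
      (s * Real.exp (-(l * s))) s := by
    intro s
    have h1 : HasDerivAt (fun s : ℝ => Real.exp (-(l * s))) (Real.exp (-(l * s)) * -(l * 1)) s :=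
      (((hasDerivAt_id s).const_mul l).neg).exp
    have h2 : HasDerivAt (fun s : ℝ => s / l + 1 / l ^ 2) (1 / l) s :=
      ((hasDerivAt_id s).div_const l).add_const _
    refine ((h2.mul h1).neg).congr_deriv ?_
    field_simp
    ring
  rw [intervalIntegral.integral_eq_sub_of_hasDerivAt (fun s _ => hd s)
    (Continuous.intervalIntegrable (by fun_prop) _ _)]
  have : 0 ≤ (r / l + 1 / l ^ 2) * Real.exp (-(l * r)) := by positivity
  simp only [zero_div, zero_add, mul_zero, neg_zero, Real.exp_zero, mul_one]
  linarith

/-- This bound is uniform in k; against the factor exp(-lr) it integrates to l⁻², which produces the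
square root of ‖A‖ in the final exponent. -/
theorem abs_sin_freq_div_le (k : ℕ) {r : ℝ} (hr : 0 ≤ r) : |Real.sin (freq k * r) / freq k| ≤ r := by
  rw [abs_div, abs_of_pos (freq_pos k), div_le_iff₀ (freq_pos k)]
  refine Real.abs_sin_le_abs.trans (le_of_eq ?_)
  rw [abs_of_nonneg (mul_nonneg (freq_pos k).le hr), mul_comm]

/-- The Duhamel operator gains a factor `l⁻²` in `L²(0,T)` with the weight `exp (-2 l t)`. -/
theorem integral_exp_mul_duhamel_sq_le {T l : ℝ} (hl : 0 < l) {v : ℝ → ℝ}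
    (hv : MemLp v 2 (muTime T)) (k : ℕ) :
    ∫ t in Ioo 0 T, Real.exp (-(2 * l * t)) * duhamel k v t ^ 2
      ≤ (1 / l ^ 2) ^ 2 * ∫ t in Ioo 0 T, Real.exp (-(2 * l * t)) * v t ^ 2 := by
  -- V carries half of the weight: exp(-lt)|v(s)| = exp(-l(t-s)) V(s), which turns the weighted
  -- problem into one with a damped convolution kernel.
  set V : ℝ → ℝ := fun s => Real.exp (-(l * s)) * |v s| with hVdef
  have hexp : ∀ s, Real.exp (-(l * s)) ^ 2 = Real.exp (-(2 * l * s)) := by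
    intro s
    rw [sq, ← Real.exp_add]
    congr 1; ring
  have hVm : MemLp V 2 (muTime T) := by
    have hb : ∀ᵐ s ∂muTime T, ‖V s‖ ≤ ‖v s‖ := by
      filter_upwards [ae_restrict_mem measurableSet_Ioo] with s hs
      rw [hVdef, Real.norm_eq_abs, Real.norm_eq_abs, abs_mul, abs_abs, abs_of_pos (Real.exp_pos _)]
      refine mul_le_of_le_one_left (abs_nonneg _) (Real.exp_le_one_iff.2 ?_)
      have := mul_pos hl hs.1
      linarith
    refine hv.mono ?_ hb
    have : Continuous fun s => Real.exp (-(l * s)) := by fun_prop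
    exact this.aestronglyMeasurable.mul hv.aestronglyMeasurable.norm
  have hVi : IntegrableOn V (Ioo 0 T) := hVm.integrable (by norm_num)
  have hV2i : IntegrableOn (fun s => V s ^ 2) (Ioo 0 T) := hVm.integrable_sq
  have hvi : IntegrableOn v (Ioo 0 T) := hv.integrable (by norm_num)
  obtain ⟨hI, hS⟩ := integral_triangle_swap hV2i
    (c := fun t s => (t - s) * Real.exp (-(l * (t - s)))) (by fun_prop)
  have hpt : ∀ t ∈ Ioo 0 T, Real.exp (-(2 * l * t)) * duhamel k v t ^ 2
      ≤ 1 / l ^ 2 * ∫ s in (0 : ℝ)..t, ((t - s) * Real.exp (-(l * (t - s)))) * V s ^ 2 := by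
    intro t ht
    have h0 : (0 : ℝ) ∈ Icc 0 T := left_mem_Icc.2 (ht.1.trans ht.2).le
    have htm : t ∈ Icc 0 T := Ioo_subset_Icc_self ht
    have hκ : Continuous fun s => (t - s) * Real.exp (-(l * (t - s))) := by fun_prop
    have iV := intervalIntegrable_of_Ioo hVi h0 htm
    have hcs := sq_integral_mul_le ht.1.le hκ
      (fun s hs => mul_nonneg (sub_nonneg.2 hs.2) (Real.exp_pos _).le)
      (K := 1 / l ^ 2) (by
        rw [intervalIntegral.integral_comp_sub_left (fun s => s * Real.exp (-(l * s))) t]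
        simpa using integral_mul_exp_neg_le hl ht.1.le) (by positivity)
      iV (intervalIntegrable_of_Ioo hV2i h0 htm)
    refine le_trans ?_ hcs
    rw [← hexp, ← mul_pow, ← sq_abs]
    refine pow_le_pow_left₀ (abs_nonneg _) ?_ 2
    rw [abs_mul, abs_of_pos (Real.exp_pos _), duhamel]
    have hi : IntervalIntegrable (fun s => Real.sin (freq k * (t - s)) / freq k * v s) volume 0 t :=
      (intervalIntegrable_of_Ioo hvi h0 htm).continuousOn_mul (by fun_prop)
    calc Real.exp (-(l * t)) * |∫ s in (0 : ℝ)..t, Real.sin (freq k * (t - s)) / freq k * v s|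
        ≤ Real.exp (-(l * t)) * ∫ s in (0 : ℝ)..t, |Real.sin (freq k * (t - s)) / freq k * v s| :=
          mul_le_mul_of_nonneg_left (intervalIntegral.abs_integral_le_integral_abs ht.1.le)
            (Real.exp_pos _).le
      _ = ∫ s in (0 : ℝ)..t,
            Real.exp (-(l * t)) * |Real.sin (freq k * (t - s)) / freq k * v s| := by
          rw [intervalIntegral.integral_const_mul]
      _ ≤ _ := by
          refine intervalIntegral.integral_mono_on ht.1.le (hi.abs.const_mul _)
            (iV.continuousOn_mul hκ.continuousOn) fun s hs => ?_
          have h1 := abs_sin_freq_div_le k (sub_nonneg.2 hs.2)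
          have e : (t - s) * Real.exp (-(l * (t - s))) * V s
              = Real.exp (-(l * t)) * ((t - s) * |v s|) := by
            have : Real.exp (-(l * t)) = Real.exp (-(l * (t - s))) * Real.exp (-(l * s)) := by
              rw [← Real.exp_add]; congr 1; ring
            rw [this, hVdef]; ring
          rw [e, abs_mul]
          gcongr
  -- This is Schur's test: one factor 1/l² is the kernel mass in s, from Cauchy-Schwarz; the other
  -- is its mass in t, after Fubini.
  calc ∫ t in Ioo 0 T, Real.exp (-(2 * l * t)) * duhamel k v t ^ 2
      ≤ ∫ t in Ioo 0 T,
          1 / l ^ 2 * ∫ s in (0 : ℝ)..t, ((t - s) * Real.exp (-(l * (t - s)))) * V s ^ 2 := by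
        refine integral_mono_of_nonneg (Filter.Eventually.of_forall fun t => by
          simp only [Pi.zero_apply]; positivity) (hI.const_mul _) ?_
        filter_upwards [ae_restrict_mem measurableSet_Ioo] with t ht using hpt t ht
    _ = 1 / l ^ 2 * ∫ s in Ioo 0 T,
          (∫ t in s..T, (t - s) * Real.exp (-(l * (t - s)))) * V s ^ 2 := by
        rw [integral_const_mul, hS]
    _ ≤ 1 / l ^ 2 * ∫ s in Ioo 0 T, 1 / l ^ 2 * V s ^ 2 := by
        refine mul_le_mul_of_nonneg_left ?_ (by positivity)
        refine integral_mono_of_nonneg ?_ (hV2i.const_mul _) ?_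
        · filter_upwards [ae_restrict_mem measurableSet_Ioo] with s hs
          refine mul_nonneg (intervalIntegral.integral_nonneg hs.2.le fun t ht =>
            mul_nonneg (sub_nonneg.2 ht.1) (Real.exp_pos _).le) (sq_nonneg _)
        · filter_upwards [ae_restrict_mem measurableSet_Ioo] with s hs
          refine mul_le_mul_of_nonneg_right ?_ (sq_nonneg _)
          rw [intervalIntegral.integral_comp_sub_right (fun t => t * Real.exp (-(l * t))) s]
          simpa using integral_mul_exp_neg_le hl (sub_nonneg.2 hs.2.le)
    _ = _ := by
        rw [integral_const_mul, ← mul_assoc, ← sq]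
        congr 2; ext s
        rw [hVdef, mul_pow, hexp, sq_abs]

/-- The energy of the `k`-th coefficient of the initial data. -/
def dataSq (φ₀ : L2Omega) (φ₁ : HNegOne) (k : ℕ) : ℝ :=
  inner ℝ (modeL2 k) φ₀ ^ 2 + (φ₁ (modeH1 k) / freq k) ^ 2

theorem dataSq_nonneg (φ₀ : L2Omega) (φ₁ : HNegOne) (k : ℕ) : 0 ≤ dataSq φ₀ φ₁ k := by
  unfold dataSq; positivity

theorem sum_dataSq_le (φ₀ : L2Omega) (φ₁ : HNegOne) (s : Finset ℕ) :
    ∑ k ∈ s, dataSq φ₀ φ₁ k ≤ ‖φ₀‖ ^ 2 + ‖φ₁‖ ^ 2 := by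
  simp only [dataSq]
  rw [Finset.sum_add_distrib]
  refine add_le_add ?_ (sum_sq_div_freq_le φ₁ s)
  refine le_trans (le_of_eq ?_) (orthonormal_modeL2.sum_inner_products_le (x := φ₀) (s := s))
  simp only [Real.norm_eq_abs, sq_abs]

theorem freeCoeff_sq_le (φ₀ : L2Omega) (φ₁ : HNegOne) (k : ℕ) (t : ℝ) :
    freeCoeff φ₀ φ₁ k t ^ 2 ≤ dataSq φ₀ φ₁ k := by
  unfold freeCoeff dataSq
  set a := inner ℝ (modeL2 k) φ₀
  set b := φ₁ (modeH1 k) / freq k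
  have h := Real.sin_sq_add_cos_sq (freq k * t)
  nlinarith [sq_nonneg (a * Real.sin (freq k * t) - b * Real.cos (freq k * t))]

theorem continuous_freeCoeff (φ₀ : L2Omega) (φ₁ : HNegOne) (k : ℕ) :
    Continuous (freeCoeff φ₀ φ₁ k) := by
  unfold freeCoeff; fun_prop

theorem integrable_section_sq {T : ℝ} {f : ℝ × ℝ → ℝ} (hf : MemLp f 2 (volume.restrict (cyl T))) :
    Integrable (fun t => ∫ x in Ioo (0 : ℝ) 1, f (x, t) ^ 2) (muTime T) :=
  (integrable_swap_cyl hf.integrable_sq).integral_prod_left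

theorem integrable_mul_coeff_sq {T : ℝ} {f : ℝ × ℝ → ℝ} (hf : MemLp f 2 (volume.restrict (cyl T)))
    {ρ : ℝ → ℝ} (hρ : Continuous ρ) (hρ1 : ∀ t ∈ Ioo 0 T, |ρ t| ≤ 1) (k : ℕ) :
    Integrable (fun t => ρ t * coeff f k t ^ 2) (muTime T) := by
  refine (memLp_coeff hf k).integrable_sq.bdd_mul (c := 1) hρ.aestronglyMeasurable ?_
  filter_upwards [ae_restrict_mem measurableSet_Ioo] with t ht using hρ1 t ht

/-- Parseval's identity, integrated in time. -/
theorem tendsto_sum_integral_coeff_sq {T : ℝ} {f : ℝ × ℝ → ℝ}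
    (hf : MemLp f 2 (volume.restrict (cyl T))) {ρ : ℝ → ℝ} (hρ : Continuous ρ)
    (hρ1 : ∀ t ∈ Ioo 0 T, |ρ t| ≤ 1) :
    Filter.Tendsto (fun N => ∑ k ∈ Finset.range N, ∫ t in Ioo 0 T, ρ t * coeff f k t ^ 2)
      Filter.atTop (nhds (∫ t in Ioo 0 T, ρ t * ∫ x in Ioo (0 : ℝ) 1, f (x, t) ^ 2)) := by
  have e : ∀ N, ∑ k ∈ Finset.range N, ∫ t in Ioo 0 T, ρ t * coeff f k t ^ 2
      = ∫ t in Ioo 0 T, ρ t * ∑ k ∈ Finset.range N, coeff f k t ^ 2 := by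
    intro N
    rw [← integral_finsetSum _ fun k _ => integrable_mul_coeff_sq hf hρ hρ1 k]
    simp only [Finset.mul_sum]
  simp only [e]
  refine tendsto_integral_of_dominated_convergence (fun t => ∫ x in Ioo (0 : ℝ) 1, f (x, t) ^ 2)
    (fun N => ?_) (integrable_section_sq hf) (fun N => ?_) ?_
  · refine hρ.aestronglyMeasurable.mul ?_
    exact Finset.aestronglyMeasurable_fun_sum _ fun k _ =>
      (memLp_coeff hf k).aestronglyMeasurable.pow 2
  · filter_upwards [memLp_section hf, ae_restrict_mem measurableSet_Ioo] with t ht htm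
    rw [norm_mul]
    have h1 := sum_coeff_sq_le ht (Finset.range N)
    have h2 : 0 ≤ ∑ k ∈ Finset.range N, coeff f k t ^ 2 :=
      Finset.sum_nonneg fun _ _ => sq_nonneg _
    rw [Real.norm_eq_abs, Real.norm_eq_abs, abs_of_nonneg h2]
    exact (mul_le_of_le_one_left h2 (hρ1 t htm)).trans h1
  · filter_upwards [memLp_section hf] with t ht
    exact (hasSum_coeff_sq ht).tendsto_sum_nat.const_mul _

theorem sum_integral_mul_coeff_sq_le {T : ℝ} {f : ℝ × ℝ → ℝ}
    (hf : MemLp f 2 (volume.restrict (cyl T))) {ρ : ℝ → ℝ} (hρ : Continuous ρ)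
    (hρ0 : ∀ t, 0 ≤ ρ t) (hρ1 : ∀ t ∈ Ioo 0 T, |ρ t| ≤ 1) (s : Finset ℕ) :
    ∑ k ∈ s, ∫ t in Ioo 0 T, ρ t * coeff f k t ^ 2
      ≤ ∫ t in Ioo 0 T, ρ t * ∫ x in Ioo (0 : ℝ) 1, f (x, t) ^ 2 := by
  rw [← integral_finsetSum _ fun k _ => integrable_mul_coeff_sq hf hρ hρ1 k]
  refine integral_mono_of_nonneg (Filter.Eventually.of_forall fun t =>
    Finset.sum_nonneg fun k _ => mul_nonneg (hρ0 t) (sq_nonneg _)) ?_ ?_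
  · refine (integrable_section_sq hf).bdd_mul (c := 1) hρ.aestronglyMeasurable ?_
    filter_upwards [ae_restrict_mem measurableSet_Ioo] with t ht using hρ1 t ht
  · filter_upwards [memLp_section hf] with t ht
    rw [← Finset.mul_sum]
    exact mul_le_mul_of_nonneg_left (sum_coeff_sq_le ht s) (hρ0 t)

theorem integral_potential_mul_sq_le {T : ℝ} (A : LinfCyl T) (φ : L2Cyl T) :
    ∀ᵐ t ∂muTime T, ∫ x in Ioo (0 : ℝ) 1, (A (x, t) * φ (x, t)) ^ 2
      ≤ ‖A‖ ^ 2 * ∫ x in Ioo (0 : ℝ) 1, φ (x, t) ^ 2 := by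
  filter_upwards [ae_ae_of_ae_cyl A.ae_abs_le, memLp_section (Lp.memLp φ)] with t h1 h2
  rw [← integral_const_mul]
  refine integral_mono_of_nonneg (Filter.Eventually.of_forall fun x => sq_nonneg _)
    (h2.integrable_sq.const_mul _) ?_
  filter_upwards [h1] with x hx
  rw [mul_pow, ← sq_abs (A (x, t))]
  gcongr

theorem norm_sq_L2Cyl {T : ℝ} (φ : L2Cyl T) :
    ‖φ‖ ^ 2 = ∫ t in Ioo 0 T, ∫ x in Ioo (0 : ℝ) 1, φ (x, t) ^ 2 := by
  rw [norm_sq_Lp_two, integral_cyl (Lp.memLp φ).integrable_sq]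

/-- Energy estimate for transposition solutions. -/
theorem norm_sq_le_of_isTranspositionSolution {T : ℝ} (hT : 0 < T) {A : LinfCyl T} {φ₀ : L2Omega}
    {φ₁ : HNegOne} {φ : L2Cyl T} (h : IsTranspositionSolution T A 0 φ₀ φ₁ φ) :
    ‖φ‖ ^ 2 ≤ Real.exp (2 * √(2 * ‖A‖ + 1) * T) * (4 * T * (‖φ₀‖ ^ 2 + ‖φ₁‖ ^ 2)) := by
  -- Here l⁴ ≥ 4‖A‖², so the feedback factor 2‖A‖²/l⁴ is at most 1/2; the summand 1 keeps l positive
  -- when A = 0.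
  set l := √(2 * ‖A‖ + 1) with hl
  have hl0 : 0 < l := Real.sqrt_pos.2 (by positivity)
  have hl2 : l ^ 2 = 2 * ‖A‖ + 1 := Real.sq_sqrt (by positivity)
  set D := ‖φ₀‖ ^ 2 + ‖φ₁‖ ^ 2 with hD
  set ρ : ℝ → ℝ := fun t => Real.exp (-(2 * l * t)) with hρd
  have hρ : Continuous ρ := by fun_prop
  have hρ0 : ∀ t, 0 ≤ ρ t := fun t => (Real.exp_pos _).le
  have hρ1 : ∀ t ∈ Ioo 0 T, |ρ t| ≤ 1 := by
    intro t ht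
    rw [abs_of_nonneg (hρ0 t)]
    refine Real.exp_le_one_iff.2 ?_
    have := mul_pos hl0 ht.1
    linarith
  have hφ := Lp.memLp φ
  have hpot := memLp_potential_mul A φ
  set I := ∫ t in Ioo 0 T, ρ t * ∫ x in Ioo (0 : ℝ) 1, φ (x, t) ^ 2 with hI
  have hint : Integrable (fun t => ρ t * ∫ x in Ioo (0 : ℝ) 1, φ (x, t) ^ 2) (muTime T) := by
    refine (integrable_section_sq hφ).bdd_mul (c := 1) hρ.aestronglyMeasurable ?_
    filter_upwards [ae_restrict_mem measurableSet_Ioo] with t ht using hρ1 t ht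
  have hI0 : 0 ≤ I := integral_nonneg fun t =>
    mul_nonneg (hρ0 t) (integral_nonneg fun x => sq_nonneg _)
  have hk : ∀ k, ∫ t in Ioo 0 T, ρ t * coeff φ k t ^ 2 ≤ 2 * T * dataSq φ₀ φ₁ k
      + 2 * (1 / l ^ 2) ^ 2 * ∫ t in Ioo 0 T, ρ t * coeff (fun p => A p * φ p) k t ^ 2 := by
    intro k
    have hm := memLp_coeff hpot k
    have hdi : Integrable (fun t => ρ t * duhamel k (coeff (fun p => A p * φ p) k) t ^ 2)
        (muTime T) :=
      (memLp_of_continuousOn (p := 1) (hρ.continuousOn.mul ((continuousOn_duhamel hT.le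
        (hm.integrable (by norm_num)) k).pow 2))).integrable le_rfl
    have h1 := integral_exp_mul_duhamel_sq_le hl0 hm k
    have h2 : ∫ t in Ioo 0 T, ρ t * coeff φ k t ^ 2 ≤ ∫ t in Ioo 0 T, (2 * dataSq φ₀ φ₁ k
        + 2 * (ρ t * duhamel k (coeff (fun p => A p * φ p) k) t ^ 2)) := by
      refine integral_mono_ae (integrable_mul_coeff_sq hφ hρ hρ1 k)
        ((integrable_const _).add (hdi.const_mul 2)) ?_
      filter_upwards [coeff_ae_eq hT h k, ae_restrict_mem measurableSet_Ioo] with t ht htm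
      rw [ht]
      have h3 := freeCoeff_sq_le φ₀ φ₁ k t
      have h4 : (freeCoeff φ₀ φ₁ k t - duhamel k (coeff (fun p => A p * φ p) k) t) ^ 2
          ≤ 2 * dataSq φ₀ φ₁ k + 2 * duhamel k (coeff (fun p => A p * φ p) k) t ^ 2 := by
        nlinarith [sq_nonneg (freeCoeff φ₀ φ₁ k t + duhamel k (coeff (fun p => A p * φ p) k) t)]
      have h5 : ρ t * (2 * dataSq φ₀ φ₁ k) ≤ 2 * dataSq φ₀ φ₁ k :=
        mul_le_of_le_one_left (mul_nonneg two_pos.le (dataSq_nonneg _ _ _))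
          ((le_abs_self _).trans (hρ1 t htm))
      have h6 := mul_le_mul_of_nonneg_left h4 (hρ0 t)
      calc _ ≤ _ := h6
        _ ≤ _ := by linarith
    rw [integral_add (integrable_const _) (hdi.const_mul 2), integral_const_mul,
      integral_const_mul, integral_const] at h2
    simp only [measureReal_restrict_apply_univ, Real.volume_real_Ioo_of_le hT.le, sub_zero,
      smul_eq_mul] at h2
    linarith
  have hsum : ∀ N, ∑ k ∈ Finset.range N, ∫ t in Ioo 0 T, ρ t * coeff φ k t ^ 2
      ≤ 2 * T * D + 2 * (1 / l ^ 2) ^ 2 * (‖A‖ ^ 2 * I) := by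
    intro N
    refine (Finset.sum_le_sum fun k _ => hk k).trans ?_
    rw [Finset.sum_add_distrib, ← Finset.mul_sum, ← Finset.mul_sum]
    refine add_le_add (mul_le_mul_of_nonneg_left (sum_dataSq_le φ₀ φ₁ _) (by positivity))
      (mul_le_mul_of_nonneg_left ?_ (by positivity))
    refine (sum_integral_mul_coeff_sq_le hpot hρ hρ0 hρ1 _).trans ?_
    rw [hI, ← integral_const_mul]
    refine integral_mono_of_nonneg (Filter.Eventually.of_forall fun t =>
      mul_nonneg (hρ0 t) (integral_nonneg fun x => sq_nonneg _)) (hint.const_mul _) ?_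
    filter_upwards [integral_potential_mul_sq_le A φ] with t ht
    calc _ ≤ ρ t * (‖A‖ ^ 2 * ∫ x in Ioo (0 : ℝ) 1, φ (x, t) ^ 2) :=
          mul_le_mul_of_nonneg_left ht (hρ0 t)
      _ = _ := by ring
  have hIle := le_of_tendsto' (tendsto_sum_integral_coeff_sq hφ hρ hρ1) hsum
  have hsmall : 2 * (1 / l ^ 2) ^ 2 * ‖A‖ ^ 2 ≤ 1 / 2 := by
    rw [hl2, div_pow, one_pow, mul_one_div, div_mul_eq_mul_div, div_le_iff₀ (by positivity)]
    nlinarith [norm_nonneg A]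
  -- Half of I is moved to the left. The absorption is legitimate because φ is in L²(Q_T) from the
  -- start.
  have hI4 : I ≤ 4 * T * D := by
    have : 2 * (1 / l ^ 2) ^ 2 * (‖A‖ ^ 2 * I) ≤ 1 / 2 * I := by
      rw [← mul_assoc]
      exact mul_le_mul_of_nonneg_right hsmall hI0
    have h2 : I ≤ 2 * T * D + 1 / 2 * I := hIle.trans (by linarith)
    linarith
  -- Removing the weight costs exp(2lT), since exp(-2lt) ≥ exp(-2lT) on (0,T).
  refine le_trans ?_ (mul_le_mul_of_nonneg_left hI4 (Real.exp_pos _).le)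
  rw [norm_sq_L2Cyl, hI, ← integral_const_mul]
  refine integral_mono_ae (integrable_section_sq hφ) (hint.const_mul _) ?_
  filter_upwards [ae_restrict_mem measurableSet_Ioo] with t ht
  rw [← mul_assoc, hρd, ← Real.exp_add]
  refine le_mul_of_one_le_left (integral_nonneg fun x => sq_nonneg _) (Real.one_le_exp ?_)
  have := mul_le_mul_of_nonneg_left ht.2.le (mul_pos two_pos hl0).le
  linarith

/-! ### Trace estimate for partial sums, uniform in x. -/

theorem sum_smul_toLp_ae {α : Type*} [MeasurableSpace α] {μ : Measure α} {f : ℕ → α → ℝ}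
    (hf : ∀ k, MemLp (f k) 2 μ) (c : ℕ → ℝ) (s : Finset ℕ) :
    ((∑ k ∈ s, c k • (hf k).toLp : Lp ℝ 2 μ) : α → ℝ) =ᵐ[μ] fun t => ∑ k ∈ s, c k * f k t := by
  induction s using Finset.induction_on with
  | empty =>
    simp only [Finset.sum_empty]
    exact Lp.coeFn_zero ℝ 2 μ
  | insert a s ha ih =>
    simp only [Finset.sum_insert ha]
    filter_upwards [Lp.coeFn_add (c a • (hf a).toLp) (∑ k ∈ s, c k • (hf k).toLp), ih,
      Lp.coeFn_smul (c a) (hf a).toLp, (hf a).coeFn_toLp] with t h1 h2 h3 h4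
    rw [h1, Pi.add_apply, h2, h3, Pi.smul_apply, h4, smul_eq_mul]

theorem norm_sq_sum_smul_toLp {α : Type*} [MeasurableSpace α] {μ : Measure α} {f : ℕ → α → ℝ}
    (hf : ∀ k, MemLp (f k) 2 μ) (c : ℕ → ℝ) (s : Finset ℕ) :
    ‖∑ k ∈ s, c k • (hf k).toLp‖ ^ 2 = ∫ t, (∑ k ∈ s, c k * f k t) ^ 2 ∂μ := by
  rw [norm_sq_Lp_two]
  refine integral_congr_ae ?_
  filter_upwards [sum_smul_toLp_ae hf c s] with t ht
  rw [ht]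

/-- Over an even length all mixed products integrate to zero, so different modes decouple in time.
This substitutes for decay in k in the trace of the free wave. -/
theorem integral_freeCoeff_mul_freeCoeff (φ₀ : L2Omega) (φ₁ : HNegOne) (j k m : ℕ) :
    ∫ t in (0 : ℝ)..(2 * m : ℕ), freeCoeff φ₀ φ₁ j t * freeCoeff φ₀ φ₁ k t
      = if j = k then m * dataSq φ₀ φ₁ k else 0 := by
  set a := fun k => inner ℝ (modeL2 k) φ₀ with ha
  set b := fun k => φ₁ (modeH1 k) / freq k with hb
  have e : ∀ t, freeCoeff φ₀ φ₁ j t * freeCoeff φ₀ φ₁ k t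
      = a j * a k * (Real.cos (freq j * t) * Real.cos (freq k * t))
        + a j * b k * (Real.cos (freq j * t) * Real.sin (freq k * t))
        + b j * a k * (Real.cos (freq k * t) * Real.sin (freq j * t))
        + b j * b k * (Real.sin (freq j * t) * Real.sin (freq k * t)) := by
    intro t; simp only [freeCoeff, ha, hb]; ring
  simp only [e]
  rw [intervalIntegral.integral_add (Continuous.intervalIntegrable (by fun_prop) _ _)
      (Continuous.intervalIntegrable (by fun_prop) _ _),
    intervalIntegral.integral_add (Continuous.intervalIntegrable (by fun_prop) _ _)
      (Continuous.intervalIntegrable (by fun_prop) _ _),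
    intervalIntegral.integral_add (Continuous.intervalIntegrable (by fun_prop) _ _)
      (Continuous.intervalIntegrable (by fun_prop) _ _)]
  simp only [intervalIntegral.integral_const_mul, integral_cos_mul_cos, integral_sin_mul_sin,
    integral_cos_mul_sin]
  split_ifs with h
  · subst h
    simp only [dataSq, ha, hb]
    push_cast
    ring
  · simp

/-- Hidden regularity of finite sums of free waves. -/
theorem integral_sum_freeCoeff_sq_le {T : ℝ} (φ₀ : L2Omega) (φ₁ : HNegOne) {m : ℕ}
    (hT : 0 < T) (hm : T ≤ (2 * m : ℕ)) {c : ℕ → ℝ} (hc : ∀ k, c k ^ 2 ≤ 2) (s : Finset ℕ) :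
    ∫ t in Ioo 0 T, (∑ k ∈ s, c k * freeCoeff φ₀ φ₁ k t) ^ 2
      ≤ 2 * m * ∑ k ∈ s, dataSq φ₀ φ₁ k := by
  have hfc := continuous_freeCoeff φ₀ φ₁
  have hcont : Continuous fun t => (∑ k ∈ s, c k * freeCoeff φ₀ φ₁ k t) ^ 2 := by fun_prop
  -- Orthogonality is available only on the even length 2m; extending the integral to it is free
  -- because the integrand is a square.
  have h1 : ∫ t in Ioo 0 T, (∑ k ∈ s, c k * freeCoeff φ₀ φ₁ k t) ^ 2
      ≤ ∫ t in (0 : ℝ)..(2 * m : ℕ), (∑ k ∈ s, c k * freeCoeff φ₀ φ₁ k t) ^ 2 := by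
    rw [← integral_Ioc_eq_integral_Ioo, ← intervalIntegral.integral_of_le hT.le]
    exact intervalIntegral.integral_mono_interval le_rfl hT.le hm
      (Filter.Eventually.of_forall fun t => sq_nonneg _) (hcont.intervalIntegrable _ _)
  refine h1.trans ?_
  have e : ∀ t, (∑ k ∈ s, c k * freeCoeff φ₀ φ₁ k t) ^ 2 = ∑ j ∈ s, ∑ k ∈ s,
      c j * c k * (freeCoeff φ₀ φ₁ j t * freeCoeff φ₀ φ₁ k t) := by
    intro t
    rw [sq, Finset.sum_mul_sum]
    refine Finset.sum_congr rfl fun j _ => Finset.sum_congr rfl fun k _ => ?_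
    ring
  simp only [e]
  rw [intervalIntegral.integral_finsetSum fun j _ =>
    Continuous.intervalIntegrable (by fun_prop) _ _, Finset.mul_sum]
  refine Finset.sum_le_sum fun j hj => ?_
  rw [intervalIntegral.integral_finsetSum fun k _ =>
    Continuous.intervalIntegrable (by fun_prop) _ _]
  simp only [intervalIntegral.integral_const_mul, integral_freeCoeff_mul_freeCoeff, mul_ite,
    mul_zero]
  rw [Finset.sum_ite_eq, if_pos hj, ← sq, mul_assoc 2]
  exact mul_le_mul_of_nonneg_right (hc j)
    (mul_nonneg (Nat.cast_nonneg m) (dataSq_nonneg _ _ _))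

/-- Here the kernel is bounded by 1/ωₖ instead of by r: the growth in T is harmless, and the decay
in k makes the constants square-summable. -/
theorem integral_duhamel_sq_le {T : ℝ} (hT : 0 < T) {v : ℝ → ℝ} (hv : MemLp v 2 (muTime T))
    (k : ℕ) : ∫ t in Ioo 0 T, duhamel k v t ^ 2
      ≤ (T / freq k) ^ 2 * ∫ t in Ioo 0 T, v t ^ 2 := by
  have hvi : IntegrableOn v (Ioo 0 T) := hv.integrable (by norm_num)
  have hv2 : IntegrableOn (fun t => v t ^ 2) (Ioo 0 T) := hv.integrable_sq
  set I := ∫ t in Ioo 0 T, v t ^ 2 with hI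
  have hpt : ∀ t ∈ Ioo 0 T, duhamel k v t ^ 2 ≤ T / freq k ^ 2 * I := by
    intro t ht
    have h0 : (0 : ℝ) ∈ Icc 0 T := left_mem_Icc.2 hT.le
    have htm : t ∈ Icc 0 T := Ioo_subset_Icc_self ht
    have iv := intervalIntegrable_of_Ioo hvi h0 htm
    have hcs := sq_integral_mul_le (κ := fun _ => 1) (K := T) ht.1.le continuous_const
      (fun _ _ => zero_le_one) (by simpa using ht.2.le) hT iv.abs
      (by simpa only [sq_abs] using intervalIntegrable_of_Ioo hv2 h0 htm)
    simp only [one_mul, sq_abs] at hcs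
    have h1 : ∫ s in (0 : ℝ)..t, v s ^ 2 ≤ I := by
      rw [intervalIntegral.integral_of_le ht.1.le, integral_Ioc_eq_integral_Ioo]
      exact setIntegral_mono_set hv2 (Filter.Eventually.of_forall fun s => sq_nonneg _)
        (Ioo_subset_Ioo_right ht.2.le).eventuallyLE
    have h2 : |duhamel k v t| ≤ (freq k)⁻¹ * ∫ s in (0 : ℝ)..t, |v s| := by
      rw [duhamel, ← intervalIntegral.integral_const_mul]
      refine (intervalIntegral.abs_integral_le_integral_abs ht.1.le).trans ?_
      refine intervalIntegral.integral_mono_on ht.1.le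
        (iv.continuousOn_mul (by fun_prop)).abs (iv.abs.const_mul _) fun s _ => ?_
      rw [abs_mul, abs_div, abs_of_pos (freq_pos k), ← one_div]
      have := freq_pos k
      gcongr
      exact Real.abs_sin_le_one _
    have h3 := pow_le_pow_left₀ (abs_nonneg _) h2 2
    rw [sq_abs, mul_pow] at h3
    refine h3.trans ?_
    calc _ ≤ (freq k)⁻¹ ^ 2 * (T * I) := by
          refine mul_le_mul_of_nonneg_left ?_ (sq_nonneg _)
          exact hcs.trans (mul_le_mul_of_nonneg_left h1 hT.le)
      _ = _ := by rw [inv_pow]; ring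
  calc _ ≤ ∫ _ in Ioo 0 T, T / freq k ^ 2 * I := by
        refine integral_mono_of_nonneg (Filter.Eventually.of_forall fun t => sq_nonneg _)
          (integrable_const _) ?_
        filter_upwards [ae_restrict_mem measurableSet_Ioo] with t ht using hpt t ht
    _ = _ := by
        rw [integral_const]
        simp only [measureReal_restrict_apply_univ, Real.volume_real_Ioo_of_le hT.le, sub_zero,
          smul_eq_mul]
        ring

theorem sum_inv_freq_sq_le (s : Finset ℕ) :
    ∑ k ∈ s, (freq k)⁻¹ ^ 2 ≤ ∑' k : ℕ, 1 / ((k : ℝ) + 1) ^ 2 := by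
  have hs : Summable fun k : ℕ => 1 / ((k : ℝ) + 1) ^ 2 := by
    have := (summable_nat_add_iff 1).2 (Real.summable_one_div_nat_pow.2 one_lt_two)
    simpa using this
  refine (Finset.sum_le_sum fun k _ => ?_).trans (hs.sum_le_tsum s fun k _ => by positivity)
  rw [inv_pow, ← one_div]
  have := succ_le_freq k
  gcongr

/-- The constant in the trace estimate for partial sums. -/
def traceConst (T : ℝ) (m : ℕ) : ℝ := 4 * m + 4 * T ^ 2 * ∑' k : ℕ, 1 / ((k : ℝ) + 1) ^ 2

theorem traceConst_nonneg (T : ℝ) (m : ℕ) : 0 ≤ traceConst T m := by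
  unfold traceConst
  have : 0 ≤ ∑' k : ℕ, 1 / ((k : ℝ) + 1) ^ 2 := tsum_nonneg fun k => by positivity
  positivity

/-- The trace estimate for finite sums of modes of a transposition solution. -/
theorem norm_sq_sum_mode_smul_le {T : ℝ} (hT : 0 < T) {m : ℕ} (hm : T ≤ (2 * m : ℕ))
    {A : LinfCyl T} {φ₀ : L2Omega} {φ₁ : HNegOne} {φ : L2Cyl T}
    (h : IsTranspositionSolution T A 0 φ₀ φ₁ φ) (s : Finset ℕ) (x : ℝ) :
    ‖∑ k ∈ s, mode k x • (memLp_coeff (Lp.memLp φ) k).toLp‖ ^ 2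
      ≤ traceConst T m * ∑ k ∈ s, (dataSq φ₀ φ₁ k
        + ∫ t in Ioo 0 T, coeff (fun p => A p * φ p) k t ^ 2) := by
  have hv := memLp_coeff (memLp_potential_mul A φ)
  have hF : ∀ k, MemLp (freeCoeff φ₀ φ₁ k) 2 (muTime T) := fun k =>
    memLp_of_continuousOn (continuous_freeCoeff φ₀ φ₁ k).continuousOn
  have hG : ∀ k, MemLp (duhamel k (coeff (fun p => A p * φ p) k)) 2 (muTime T) := fun k =>
    memLp_of_continuousOn (continuousOn_duhamel hT.le ((hv k).integrable (by norm_num)) k)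
  set η : ℕ → ℝ := fun k => ∫ t in Ioo 0 T, coeff (fun p => A p * φ p) k t ^ 2 with hη
  have hη0 : ∀ k, 0 ≤ η k := fun k => integral_nonneg fun t => sq_nonneg _
  have hc : ∀ k, mode k x ^ 2 ≤ 2 := fun k => by
    have := pow_le_pow_left₀ (abs_nonneg _) (abs_mode_le k x) 2
    rwa [sq_abs, Real.sq_sqrt two_pos.le] at this
  have e : ∀ k, (memLp_coeff (Lp.memLp φ) k).toLp = (hF k).toLp - (hG k).toLp := by
    intro k
    rw [← MemLp.toLp_sub]
    exact MemLp.toLp_congr _ _ (coeff_ae_eq hT h k)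
  have e2 : ∑ k ∈ s, mode k x • (memLp_coeff (Lp.memLp φ) k).toLp
      = ∑ k ∈ s, mode k x • (hF k).toLp - ∑ k ∈ s, mode k x • (hG k).toLp := by
    rw [← Finset.sum_sub_distrib]
    refine Finset.sum_congr rfl fun k _ => ?_
    rw [e, smul_sub]
  have hFle : ‖∑ k ∈ s, mode k x • (hF k).toLp‖ ^ 2 ≤ 2 * m * ∑ k ∈ s, dataSq φ₀ φ₁ k := by
    rw [norm_sq_sum_smul_toLp]
    exact integral_sum_freeCoeff_sq_le φ₀ φ₁ hT hm hc s
  set Z := ∑' k : ℕ, 1 / ((k : ℝ) + 1) ^ 2 with hZ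
  have hGk : ∀ k, ‖mode k x • (hG k).toLp‖ ≤ (√2 * T * (freq k)⁻¹) * √(η k) := by
    intro k
    have h1 : ‖(hG k).toLp‖ ≤ T / freq k * √(η k) := by
      refine (sq_le_sq₀ (norm_nonneg _) (by have := freq_pos k; positivity)).1 ?_
      rw [norm_sq_toLp, mul_pow, Real.sq_sqrt (hη0 k)]
      exact integral_duhamel_sq_le hT (hv k) k
    rw [norm_smul]
    calc _ ≤ √2 * (T / freq k * √(η k)) :=
          mul_le_mul (abs_mode_le k x) h1 (norm_nonneg _) (Real.sqrt_nonneg _)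
      _ = _ := by ring
  -- The triangle inequality over the modes is affordable: Cauchy-Schwarz separates the summable
  -- 1/ωₖ² from the coefficients of Aφ.
  have hGle : ‖∑ k ∈ s, mode k x • (hG k).toLp‖ ^ 2 ≤ 2 * T ^ 2 * Z * ∑ k ∈ s, η k := by
    have h1 := (norm_sum_le s fun k => mode k x • (hG k).toLp).trans
      (Finset.sum_le_sum fun k _ => hGk k)
    refine (pow_le_pow_left₀ (norm_nonneg _) h1 2).trans ?_
    refine (Finset.sum_mul_sq_le_sq_mul_sq s _ _).trans ?_
    simp only [Real.sq_sqrt (hη0 _)]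
    refine mul_le_mul_of_nonneg_right ?_ (Finset.sum_nonneg fun k _ => hη0 k)
    have h2 : ∀ k, (√2 * T * (freq k)⁻¹) ^ 2 = 2 * T ^ 2 * (freq k)⁻¹ ^ 2 := by
      intro k; rw [mul_pow, mul_pow, Real.sq_sqrt two_pos.le]
    simp only [h2]
    rw [← Finset.mul_sum]
    exact mul_le_mul_of_nonneg_left (sum_inv_freq_sq_le s) (by positivity)
  rw [e2, Finset.sum_add_distrib]
  set u := ∑ k ∈ s, mode k x • (hF k).toLp
  set w := ∑ k ∈ s, mode k x • (hG k).toLp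
  have huw : ‖u - w‖ ^ 2 ≤ 2 * ‖u‖ ^ 2 + 2 * ‖w‖ ^ 2 := by
    have := pow_le_pow_left₀ (norm_nonneg _) (norm_sub_le u w) 2
    nlinarith [sq_nonneg (‖u‖ - ‖w‖)]
  have hd0 : 0 ≤ ∑ k ∈ s, dataSq φ₀ φ₁ k := Finset.sum_nonneg fun k _ => dataSq_nonneg _ _ _
  have he0 : 0 ≤ ∑ k ∈ s, η k := Finset.sum_nonneg fun k _ => hη0 k
  have hZ0 : 0 ≤ Z := tsum_nonneg fun k => by positivity
  -- Splitting ‖u - w‖² doubles both bounds, giving 4m and 4T²Z. The nonnegative products `x1` and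
  -- `x2` are the slack from using the sum of the two constants on both sums.
  unfold traceConst
  rw [← hZ]
  have x1 : 0 ≤ (m : ℝ) * ∑ k ∈ s, η k := by positivity
  have x2 : 0 ≤ T ^ 2 * Z * ∑ k ∈ s, dataSq φ₀ φ₁ k := by positivity
  linarith

/-! ### Convergence of the expansion and identification of its limit. -/

/-- A series of continuous functions whose partial sums are square-bounded by the partial sums of a
summable numerical series converges uniformly to a continuous function. -/
theorem exists_tendstoUniformlyOn_of_norm_sq_le {E : Type*} [NormedAddCommGroup E] [CompleteSpace E]
    {f : ℕ → ℝ → E} {K : Set ℝ} {d : ℕ → ℝ} {C : ℝ} (hC : 0 ≤ C) (hf : ∀ k, ContinuousOn (f k) K)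
    (hd0 : ∀ k, 0 ≤ d k) (hd : Summable d)
    (hb : ∀ s : Finset ℕ, ∀ x ∈ K, ‖∑ k ∈ s, f k x‖ ^ 2 ≤ C * ∑ k ∈ s, d k) :
    ∃ Φ : ℝ → E, ContinuousOn Φ K ∧
      (∀ x ∈ K, Filter.Tendsto (fun N => ∑ k ∈ Finset.range N, f k x) Filter.atTop (nhds (Φ x))) ∧
      ∀ x ∈ K, ‖Φ x‖ ^ 2 ≤ C * ∑' k, d k := by
  classical
  have hcau : UniformCauchySeqOn (fun N x => ∑ k ∈ Finset.range N, f k x) Filter.atTop K := by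
    rw [Metric.uniformCauchySeqOn_iff]
    intro ε hε
    -- C may vanish, hence the division by C + 1.
    have hpos : 0 < ε ^ 2 / (C + 1) := by positivity
    obtain ⟨N, hN⟩ := Metric.cauchySeq_iff.1 hd.hasSum.tendsto_sum_nat.cauchySeq _ hpos
    refine ⟨N, fun m hm n hn x hx => ?_⟩
    wlog hmn : m ≤ n generalizing m n
    · rw [dist_comm]; exact this n hn m hm (le_of_not_ge hmn)
    rw [dist_comm, dist_eq_norm, ← Finset.sum_Ico_eq_sub _ hmn]
    refine lt_of_pow_lt_pow_left₀ 2 hε.le ((hb _ x hx).trans_lt ?_)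
    have h1 := hN n hn m hm
    rw [Real.dist_eq, ← Finset.sum_Ico_eq_sub _ hmn,
      abs_of_nonneg (Finset.sum_nonneg fun k _ => hd0 k), lt_div_iff₀ (by positivity)] at h1
    have h2 : 0 ≤ ∑ k ∈ Finset.Ico m n, d k := Finset.sum_nonneg fun k _ => hd0 k
    linarith
  -- The membership stands inside the existential so that the choice gives a total function Φ, with
  -- value 0 available off K.
  have hlim : ∀ x, ∃ y, x ∈ K →
      Filter.Tendsto (fun N => ∑ k ∈ Finset.range N, f k x) Filter.atTop (nhds y) := by
    intro x
    by_cases hx : x ∈ K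
    · obtain ⟨y, hy⟩ := cauchySeq_tendsto_of_complete (hcau.cauchySeq hx)
      exact ⟨y, fun _ => hy⟩
    · exact ⟨0, fun h => absurd h hx⟩
  choose Φ hΦ using hlim
  refine ⟨Φ, ?_, hΦ, fun x hx => ?_⟩
  · refine (hcau.tendstoUniformlyOn_of_tendsto hΦ).continuousOn
      (Filter.Frequently.of_forall fun N => ?_)
    exact continuousOn_finsetSum _ fun k _ => hf k
  · refine le_of_tendsto' (((hΦ x hx).norm).pow 2) fun N => (hb _ x hx).trans ?_
    exact mul_le_mul_of_nonneg_left (hd.sum_le_tsum _ fun k _ => hd0 k) hC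

theorem memLp_partialSum {T : ℝ} {f : ℝ × ℝ → ℝ} (hf : MemLp f 2 (volume.restrict (cyl T)))
    (N : ℕ) : MemLp (fun p : ℝ × ℝ => ∑ k ∈ Finset.range N, mode k p.1 * coeff f k p.2) 2
      (volume.restrict (cyl T)) := by
  refine memLp_finsetSum _ fun k _ => ?_
  have h1 : MemLp (fun p : ℝ × ℝ => coeff f k p.2) 2 (volume.restrict (cyl T)) := by
    rw [restrict_cyl]
    exact (memLp_coeff hf k).comp_snd muOmega
  have h2 : MemLp (fun p : ℝ × ℝ => mode k p.1) ⊤ (volume.restrict (cyl T)) :=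
    memLp_top_of_bound (by fun_prop) (√2) (Filter.Eventually.of_forall fun p => abs_mode_le k p.1)
  exact h1.mul' h2

/-- Parseval's identity for the remainder of the expansion of `f` along the eigenfunctions. -/
theorem integral_sub_partialSum_sq {f : ℝ × ℝ → ℝ} {t : ℝ}
    (hf : MemLp (fun x => f (x, t)) 2 muOmega) (N : ℕ) :
    ∫ x in Ioo (0 : ℝ) 1, (f (x, t) - ∑ k ∈ Finset.range N, mode k x * coeff f k t) ^ 2
      = (∫ x in Ioo (0 : ℝ) 1, f (x, t) ^ 2) - ∑ k ∈ Finset.range N, coeff f k t ^ 2 := by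
  set u := hf.toLp with hu
  set v : L2Omega := ∑ k ∈ Finset.range N, coeff f k t • modeL2 k with hv
  have e1 : ∫ x in Ioo (0 : ℝ) 1, (f (x, t) - ∑ k ∈ Finset.range N, mode k x * coeff f k t) ^ 2
      = ‖u - v‖ ^ 2 := by
    rw [norm_sq_Lp_two]
    refine integral_congr_ae ?_
    filter_upwards [hf.coeFn_toLp, Lp.coeFn_sub u v,
      sum_smul_toLp_ae memLp_mode (fun k => coeff f k t) (Finset.range N)] with x h1 h2 h3
    rw [h2, Pi.sub_apply, hu, h1, hv]
    simp only [modeL2]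
    rw [h3]
    simp only [mul_comm]
  have e2 : inner ℝ u v = ∑ k ∈ Finset.range N, coeff f k t ^ 2 := by
    rw [hv, inner_sum]
    refine Finset.sum_congr rfl fun k _ => ?_
    rw [real_inner_smul_right, real_inner_comm, hu, ← coeff_eq_inner hf, sq]
  have e3 : ‖v‖ ^ 2 = ∑ k ∈ Finset.range N, coeff f k t ^ 2 := by
    rw [← real_inner_self_eq_norm_sq, hv, orthonormal_modeL2.inner_sum]
    refine Finset.sum_congr rfl fun k _ => ?_
    simp [sq]
  rw [e1, norm_sub_sq_real, e2, e3, hu, norm_sq_toLp]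
  ring

theorem integral_cyl' {T : ℝ} {f : ℝ × ℝ → ℝ} (hf : Integrable f (volume.restrict (cyl T))) :
    ∫ p in cyl T, f p = ∫ x in Ioo (0 : ℝ) 1, ∫ t in Ioo 0 T, f (x, t) := by
  rw [restrict_cyl] at hf ⊢
  exact integral_prod f hf

theorem memLp_section_time {T : ℝ} {f : ℝ × ℝ → ℝ} (hf : MemLp f 2 (volume.restrict (cyl T))) :
    ∀ᵐ x ∂muOmega, MemLp (fun t => f (x, t)) 2 (muTime T) := by
  rw [restrict_cyl] at hf
  filter_upwards [hf.aestronglyMeasurable.prodMk_left, hf.integrable_sq.prod_right_ae] with x h1 h2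
  exact (memLp_two_iff_integrable_sq h1).2 h2

/-- Integrated in time, the Parseval remainder of each slice is the full norm minus its partial sum.
The factors 1 are the trivial weight in `tendsto_sum_integral_coeff_sq`. -/
theorem tendsto_integral_sub_partialSum_sq {T : ℝ} {f : ℝ × ℝ → ℝ}
    (hf : MemLp f 2 (volume.restrict (cyl T))) :
    Filter.Tendsto (fun N => ∫ x in Ioo (0 : ℝ) 1, ∫ t in Ioo 0 T,
      (f (x, t) - ∑ k ∈ Finset.range N, mode k x * coeff f k t) ^ 2) Filter.atTop (nhds 0) := by
  have e : ∀ N, ∫ x in Ioo (0 : ℝ) 1, ∫ t in Ioo 0 T,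
      (f (x, t) - ∑ k ∈ Finset.range N, mode k x * coeff f k t) ^ 2
      = (∫ t in Ioo 0 T, 1 * ∫ x in Ioo (0 : ℝ) 1, f (x, t) ^ 2)
        - ∑ k ∈ Finset.range N, ∫ t in Ioo 0 T, 1 * coeff f k t ^ 2 := by
    intro N
    have hi := (hf.sub (memLp_partialSum hf N)).integrable_sq
    simp only [Pi.sub_apply] at hi
    rw [← integral_cyl' hi, integral_cyl hi]
    simp only [one_mul]
    rw [← integral_finsetSum _ fun k _ => (memLp_coeff hf k).integrable_sq,
      ← integral_sub (integrable_section_sq hf)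
        (integrable_finsetSum _ fun k _ => (memLp_coeff hf k).integrable_sq)]
    refine integral_congr_ae ?_
    filter_upwards [memLp_section hf] with t ht
    exact integral_sub_partialSum_sq ht N
  simp only [e]
  have := (tendsto_sum_integral_coeff_sq hf (ρ := fun _ => 1) continuous_const
    (fun _ _ => by simp)).const_sub (∫ t in Ioo 0 T, 1 * ∫ x in Ioo (0 : ℝ) 1, f (x, t) ^ 2)
  simpa using this

/-- A pointwise limit in `L²(0,T)` of the expansion along the eigenfunctions is `f` itself. -/
theorem ae_eq_of_tendsto_partialSum {T : ℝ} {f : ℝ × ℝ → ℝ}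
    (hf : MemLp f 2 (volume.restrict (cyl T))) {Φ : ℝ → L2Time T}
    (hΦ : ∀ x ∈ Icc (0 : ℝ) 1, Filter.Tendsto
      (fun N => ∑ k ∈ Finset.range N, mode k x • (memLp_coeff hf k).toLp) Filter.atTop
      (nhds (Φ x))) :
    ∀ᵐ x ∂muOmega, Φ x =ᵐ[muTime T] fun t => f (x, t) := by
  set r : ℕ → ℝ → ℝ := fun N x => ∫ t in Ioo 0 T,
    (f (x, t) - ∑ k ∈ Finset.range N, mode k x * coeff f k t) ^ 2 with hr
  have hri : ∀ N, Integrable (r N) muOmega := by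
    intro N
    have hi := (hf.sub (memLp_partialSum hf N)).integrable_sq
    simp only [Pi.sub_apply] at hi
    rw [restrict_cyl] at hi
    exact hi.integral_prod_left
  have hr0 : ∀ N x, 0 ≤ r N x := fun N x => integral_nonneg fun t => sq_nonneg _
  have hlim : Filter.Tendsto (fun N => eLpNorm (r N - 0) 1 muOmega) Filter.atTop (nhds 0) := by
    have e : ∀ N, eLpNorm (r N - 0) 1 muOmega = ENNReal.ofReal (∫ x in Ioo (0 : ℝ) 1, r N x) := by
      intro N
      rw [sub_zero, eLpNorm_one_eq_lintegral_enorm, ← ofReal_integral_norm_eq_lintegral_enorm (hri N)]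
      congr 2; ext x
      rw [Real.norm_eq_abs, abs_of_nonneg (hr0 N x)]
    simp only [e]
    rw [← ENNReal.ofReal_zero]
    exact ENNReal.tendsto_ofReal (tendsto_integral_sub_partialSum_sq hf)
  -- Convergence in L²(Q_T) says that the squared slice errors `r N` tend to 0 in L¹(Ω). A
  -- subsequence does so for a.e. x, where the limit must agree with the given limit Φ(x).
  obtain ⟨ns, hns, hae⟩ := (tendstoInMeasure_of_tendsto_eLpNorm one_ne_zero
    (fun N => (hri N).aestronglyMeasurable) aestronglyMeasurable_zero hlim).exists_seq_tendsto_ae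
  filter_upwards [hae, memLp_section_time hf, ae_restrict_mem measurableSet_Ioo] with x h1 h2 hx
  have e : ∀ N, ‖h2.toLp - ∑ k ∈ Finset.range N, mode k x • (memLp_coeff hf k).toLp‖ ^ 2
      = r N x := by
    intro N
    rw [norm_sq_Lp_two]
    refine integral_congr_ae ?_
    filter_upwards [h2.coeFn_toLp, Lp.coeFn_sub h2.toLp
      (∑ k ∈ Finset.range N, mode k x • (memLp_coeff hf k).toLp),
      sum_smul_toLp_ae (memLp_coeff hf) (fun k => mode k x) (Finset.range N)] with t a1 a2 a3
    rw [a2, Pi.sub_apply, a1, a3]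
  have h3 := ((((hΦ x (Ioo_subset_Icc_self hx)).comp hns.tendsto_atTop).const_sub h2.toLp).norm).pow 2
  have h4 : Filter.Tendsto (fun i => r (ns i) x) Filter.atTop (nhds (‖h2.toLp - Φ x‖ ^ 2)) := by
    refine h3.congr fun i => ?_
    simp only [Function.comp]
    exact e (ns i)
  have h5 : ‖h2.toLp - Φ x‖ ^ 2 = 0 := tendsto_nhds_unique h4 h1
  rw [← sub_eq_zero.1 (norm_eq_zero.1 (pow_eq_zero_iff two_ne_zero |>.1 h5))]
  exact h2.coeFn_toLp

/-! ### The trace and the form of the constant. -/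

theorem sum_integral_coeff_potential_le {T : ℝ} (A : LinfCyl T) (φ : L2Cyl T) (s : Finset ℕ) :
    ∑ k ∈ s, ∫ t in Ioo 0 T, coeff (fun p => A p * φ p) k t ^ 2 ≤ ‖A‖ ^ 2 * ‖φ‖ ^ 2 := by
  have h1 := sum_integral_mul_coeff_sq_le (memLp_potential_mul A φ) (ρ := fun _ => 1)
    continuous_const (fun _ => zero_le_one) (fun _ _ => by simp) s
  simp only [one_mul] at h1
  refine h1.trans ?_
  rw [norm_sq_L2Cyl, ← integral_const_mul]
  exact integral_mono_of_nonneg (Filter.Eventually.of_forall fun t => integral_nonneg fun x =>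
    sq_nonneg _) ((integrable_section_sq (Lp.memLp φ)).const_mul _)
    (integral_potential_mul_sq_le A φ)

/-- Existence of the trace, with an estimate in terms of the data and of `A φ`. -/
theorem exists_trace {T : ℝ} (hT : 0 < T) {m : ℕ} (hm : T ≤ (2 * m : ℕ))
    {A : LinfCyl T} {φ₀ : L2Omega} {φ₁ : HNegOne} {φ : L2Cyl T}
    (h : IsTranspositionSolution T A 0 φ₀ φ₁ φ) :
    ∃ θ : L2Time T, IsTraceAtOne T φ θ ∧
      ‖θ‖ ^ 2 ≤ traceConst T m * (‖φ₀‖ ^ 2 + ‖φ₁‖ ^ 2 + ‖A‖ ^ 2 * ‖φ‖ ^ 2) := by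
  set d : ℕ → ℝ := fun k => dataSq φ₀ φ₁ k
    + ∫ t in Ioo 0 T, coeff (fun p => A p * φ p) k t ^ 2 with hd
  have hd0 : ∀ k, 0 ≤ d k := fun k =>
    add_nonneg (dataSq_nonneg _ _ _) (integral_nonneg fun t => sq_nonneg _)
  have hds : ∀ s : Finset ℕ, ∑ k ∈ s, d k ≤ ‖φ₀‖ ^ 2 + ‖φ₁‖ ^ 2 + ‖A‖ ^ 2 * ‖φ‖ ^ 2 := by
    intro s
    rw [hd, Finset.sum_add_distrib]
    exact add_le_add (sum_dataSq_le φ₀ φ₁ s) (sum_integral_coeff_potential_le A φ s)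
  have hsum : Summable d := summable_of_sum_le hd0 hds
  obtain ⟨Φ, h1, h2, h3⟩ := exists_tendstoUniformlyOn_of_norm_sq_le (K := Icc (0 : ℝ) 1)
    (f := fun k x => mode k x • (memLp_coeff (Lp.memLp φ) k).toLp) (traceConst_nonneg T m)
    (fun k => ((continuous_mode k).smul continuous_const).continuousOn) hd0 hsum
    fun s x _ => norm_sq_sum_mode_smul_le hT hm h s x
  refine ⟨Φ 1, ⟨Φ, h1, ae_eq_of_tendsto_partialSum (Lp.memLp φ) h2, rfl⟩,
    (h3 1 (right_mem_Icc.2 zero_le_one)).trans ?_⟩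
  exact mul_le_mul_of_nonneg_left (hsum.tsum_le_of_sum_le hds) (traceConst_nonneg T m)

/-- With y = √a, the polynomial factor is absorbed by a ≤ 2 exp(y), and the rate by √(2a+1) ≤ 1 +
2y. The exponent is therefore linear in √a; 16T exp(2T) collects 4 · 4T and the constant part of the
rate. -/
theorem one_add_sq_mul_exp_le {T a : ℝ} (hT : 0 < T) (ha : 0 ≤ a) :
    1 + a ^ 2 * (Real.exp (2 * √(2 * a + 1) * T) * (4 * T))
      ≤ (1 + 16 * T * Real.exp (2 * T)) * Real.exp ((1 + 2 * T) * √a) ^ 2 := by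
  set y := √a with hy
  have hy0 : 0 ≤ y := Real.sqrt_nonneg a
  have hya : a = y ^ 2 := (Real.sq_sqrt ha).symm
  have h1 : a ≤ 2 * Real.exp y := by
    have := Real.quadratic_le_exp_of_nonneg hy0
    rw [hya]; linarith
  have h2 : √(2 * a + 1) ≤ 1 + 2 * y := by
    rw [Real.sqrt_le_left (by positivity), hya]
    nlinarith
  have h3 : Real.exp (2 * √(2 * a + 1) * T) ≤ Real.exp (2 * T) * Real.exp (4 * T * y) := by
    rw [← Real.exp_add]
    refine Real.exp_le_exp.2 ?_
    have := mul_le_mul_of_nonneg_right h2 hT.le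
    linarith
  have h4 : a ^ 2 ≤ 4 * Real.exp (2 * y) := by
    have := pow_le_pow_left₀ ha h1 2
    have e : Real.exp y ^ 2 = Real.exp (2 * y) := by rw [sq, ← Real.exp_add]; congr 1; ring
    rw [mul_pow, e] at this
    linarith
  have h5 : Real.exp ((1 + 2 * T) * y) ^ 2 = Real.exp (2 * y) * Real.exp (4 * T * y) := by
    rw [sq, ← Real.exp_add, ← Real.exp_add]; congr 1; ring
  have h6 : (1 : ℝ) ≤ Real.exp ((1 + 2 * T) * y) ^ 2 :=
    one_le_pow₀ (Real.one_le_exp (by positivity))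
  have h7 : a ^ 2 * (Real.exp (2 * √(2 * a + 1) * T) * (4 * T))
      ≤ (4 * Real.exp (2 * y)) * ((Real.exp (2 * T) * Real.exp (4 * T * y)) * (4 * T)) := by
    gcongr
  rw [h5] at h6 ⊢
  calc _ ≤ Real.exp (2 * y) * Real.exp (4 * T * y) + _ := add_le_add h6 h7
    _ = _ := by ring

end HiddenReg

end

theorem proposition1 (T : ℝ) (hT : 0 < T) :
    ∃ C : ℝ, 0 < C ∧
      ∀ (A : HiddenReg.LinfCyl T) (φ₀ : HiddenReg.L2Omega) (φ₁ : HiddenReg.HNegOne)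
        (φ : HiddenReg.L2Cyl T),
        HiddenReg.IsTranspositionSolution T A 0 φ₀ φ₁ φ →
          ∃ θ : HiddenReg.L2Time T, HiddenReg.IsTraceAtOne T φ θ ∧
            ‖θ‖ ≤ C * Real.exp (C * Real.sqrt ‖A‖) * Real.sqrt (‖φ₀‖ ^ 2 + ‖φ₁‖ ^ 2) := by
  -- The even length 2m covering (0,T) depends on T alone, and so does every constant built from it.
  obtain ⟨m, hm⟩ := exists_nat_ge T
  have hm2 : T ≤ (2 * m : ℕ) := by
    push_cast
    have : (0 : ℝ) ≤ m := Nat.cast_nonneg m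
    linarith
  have hK0 := HiddenReg.traceConst_nonneg T m
  set K := HiddenReg.traceConst T m with hK
  set B : ℝ := K * (1 + 16 * T * Real.exp (2 * T)) with hB
  have hB0 : 0 ≤ B := by positivity
  -- A single C must serve as prefactor, where √B suffices, and as rate, where 1 + 2T suffices;
  -- their sum dominates both.
  refine ⟨√B + (1 + 2 * T), by positivity, fun A φ₀ φ₁ φ h => ?_⟩
  obtain ⟨θ, hθ, hle⟩ := HiddenReg.exists_trace hT hm2 h
  refine ⟨θ, hθ, ?_⟩
  set D : ℝ := ‖φ₀‖ ^ 2 + ‖φ₁‖ ^ 2 with hD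
  have hD0 : 0 ≤ D := by positivity
  have hE := HiddenReg.norm_sq_le_of_isTranspositionSolution hT h
  have hsq : ‖θ‖ ^ 2 ≤ (√B * Real.exp ((1 + 2 * T) * √‖A‖) * √D) ^ 2 := by
    rw [mul_pow, mul_pow, Real.sq_sqrt hB0, Real.sq_sqrt hD0]
    refine hle.trans ?_
    have h1 := HiddenReg.one_add_sq_mul_exp_le hT (norm_nonneg A)
    calc K * (D + ‖A‖ ^ 2 * ‖φ‖ ^ 2)
        ≤ K * (D + ‖A‖ ^ 2 * (Real.exp (2 * √(2 * ‖A‖ + 1) * T) * (4 * T * D))) := by gcongr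
      _ = K * ((1 + ‖A‖ ^ 2 * (Real.exp (2 * √(2 * ‖A‖ + 1) * T) * (4 * T))) * D) := by ring
      _ ≤ K * (((1 + 16 * T * Real.exp (2 * T)) * Real.exp ((1 + 2 * T) * √‖A‖) ^ 2) * D) := by
          gcongr
      _ = _ := by rw [hB]; ring
  refine ((sq_le_sq₀ (norm_nonneg _) (by positivity)).1 hsq).trans ?_
  have hsB := Real.sqrt_nonneg B
  have hC1 : √B ≤ √B + (1 + 2 * T) := by linarith
  have hC2 : 1 + 2 * T ≤ √B + (1 + 2 * T) := by linarith
  gcongr
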